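/- **Theorem (the fractional integral operator $S^s$).** Let $n\ge 3$ and $0<s<1$. Let $\mathbb S^{n-1}$ be the unit sphere of $\mathbb R^n$ with its surface measure $\mathcal H^{n-1}$, total mass $\omega_{n-1}=2\pi^{n/2}/\Gamma(n/2)$, and geodesic distance $d(x,y)=\arccos(x\cdot y)$. For $k\ge 0$ let $SH^k$ be the space of spherical harmonics of degree $k$ (restrictions to $\mathbb S^{n-1}$ of harmonic homogeneous polynomials of degree $k$), let $\{Y_{k,l}\}_{1\le l\le \dim SH^k}$ be any basis of $SH^k$ that is orthonormal in $L^2(\mathbb S^{n-1})$, and let $$P_ku=\sum_l\Big(\int_{\mathbb S^{n-1}}u\,Y_{k,l}\,d\mathcal H^{n-1}\Big)Y_{k,l},\qquad e^{-tL}u(x)=\sum_{k=0}^\infty e^{-tk}P_ku(x)\quad(t>0)$$ be the orthogonal projector onto $SH^k$ and the semigroup generated by the Dirichlet-to-Neumann operator $Lu=\sum_{k}k\,P_ku$ of the unit ball. Let $$P_r(\tau)=\frac{1-r^2}{\omega_{n-1}(1-2r\tau+r^2)^{n/2}}$$ be the Poisson kernel and, for $z>0$, let $$\mathcal B_\rho(z)=\mathcal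 I_\rho(z)-\frac{(z/2)^\rho}{\Gamma(\rho+1)}=\sum_{m=1}^\infty\frac{(z/2)^{2m+\rho}}{\Gamma(m+1)\Gamma(m+\rho+1)},$$ where $\mathcal I_\rho$ is the modified Bessel function of the first kind and $1/\Gamma=0$ at the poles of $\Gamma$. For $u\in C^\infty(\mathbb S^{n-1})$ real-valued and $x\in\mathbb S^{n-1}$ let $$S^su(x)=\frac{(n-2)^{s+1/2}}{\pi^{-1/2}\Gamma(-s)}\int_0^\infty e^{-t\frac{n-2}{2}}\,e^{-tL}u(x)\,\mathcal B_{-s-1/2}\big(\tfrac{n-2}{2}t\big)\,\frac{dt}{t^{1/2+s}}.$$ The series defining $e^{-tL}u(x)$, $t>0$, and the integral defining $S^su(x)$ converge absolutely, and $$S^su(x)=\int_{\mathbb S^{n-1}}S_s(x\cdot y)\,u(y)\,d\mathcal H^{n-1}(y)$$ with an absolutely convergent integral, where for $x\ne y$ the kernel is given by the absolutely convergent integral $$S_s(x\cdot y)=\frac{(n-2)^{s+1/2}}{\pi^{-1/2}\Gamma(-s)}\int_0^\infty e^{-t\frac{n-2}{2}}\,P_{e^{-t}}(x\cdot y)\,\mathcal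 B_{-s-1/2}\big(\tfrac{n-2}{2}t\big)\,\frac{dt}{t^{1/2+s}}.$$ Moreover there is a constant $c_{n,s}>0$, depending only on $n$ and $s$, such that $$|S_s(x\cdot y)|\le\frac{c_{n,s}}{d(x,y)^{(n-1)-(2-2s)}}\qquad\text{for all }x,y\in\mathbb S^{n-1},\ x\neq y,$$ that is, $S^s$ is a fractional integral operator of order $2-2s$. -/

import Mathlib

open MeasureTheory Set
open scoped ContDiff

noncomputable section

namespace SphereFrac

/-- The ambient Euclidean space `ℝⁿ`. -/
abbrev E (n : ℕ) : Type := EuclideanSpace ℝ (Fin n)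

/-- The unit sphere `𝕊ⁿ⁻¹` of `ℝⁿ`. -/
abbrev Sph (n : ℕ) : Type := Metric.sphere (0 : E n) 1

/-- The surface measure of `𝕊ⁿ⁻¹` induced by Lebesgue measure, that is, the normalized
`(n-1)`-dimensional Hausdorff measure; its total mass is `2 π^(n/2) / Γ(n/2)`. -/
def surf (n : ℕ) : Measure (Sph n) := (volume : Measure (E n)).toSphere

/-- The surface area `ω_{n-1} = 2 π^(n/2) / Γ(n/2)` of `𝕊ⁿ⁻¹`. -/
def sphereArea (n : ℕ) : ℝ := 2 * Real.pi ^ ((n : ℝ) / 2) / Real.Gamma ((n : ℝ) / 2)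

/-- The scalar product `x · y` of two points of the sphere. -/
def dot {n : ℕ} (x y : Sph n) : ℝ := inner ℝ (x : E n) (y : E n)

/-- The geodesic distance `d(x,y) = arccos (x · y)`. -/
def geoDist {n : ℕ} (x y : Sph n) : ℝ := Real.arccos (dot x y)

open Classical in
/-- The extension `ũ(X) = u(X/|X|)`, `X ≠ 0`, constant along the normal lines to the sphere
(the value at the origin is irrelevant). -/
def normalExt {n : ℕ} (u : Sph n → ℝ) (X : E n) : ℝ :=
  if h : ‖X‖⁻¹ • X ∈ Metric.sphere (0 : E n) 1 then u ⟨‖X‖⁻¹ • X, h⟩ else 0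

/-- `u ∈ C^∞(𝕊ⁿ⁻¹)`: the extension of `u` is `C^∞` in a neighbourhood of the sphere. -/
def SmoothOnSphere {n : ℕ} (u : Sph n → ℝ) : Prop :=
  ∃ U : Set (E n), IsOpen U ∧ Metric.sphere (0 : E n) 1 ⊆ U ∧ ContDiffOn ℝ ∞ (normalExt u) U

/-! ### Spherical harmonics and the Dirichlet-to-Neumann operator -/

/-- The Laplacian on real polynomials in `n` variables. -/
def polyLaplacian (n : ℕ) : MvPolynomial (Fin n) ℝ →ₗ[ℝ] MvPolynomial (Fin n) ℝ :=
  ∑ i : Fin n, (MvPolynomial.pderiv i).toLinearMap ∘ₗ (MvPolynomial.pderiv i).toLinearMap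

/-- Restriction of a polynomial to the sphere, as a function. -/
def polyRestrict (n : ℕ) : MvPolynomial (Fin n) ℝ →ₗ[ℝ] (Sph n → ℝ) :=
  LinearMap.pi fun x => (MvPolynomial.aeval fun i => (x : E n) i).toLinearMap

/-- `SH^k`: restrictions to the sphere of the harmonic homogeneous polynomials of degree `k`. -/
def SH (n k : ℕ) : Submodule ℝ (Sph n → ℝ) :=
  (MvPolynomial.homogeneousSubmodule (Fin n) ℝ k ⊓ LinearMap.ker (polyLaplacian n)).map
    (polyRestrict n)

/-- For every `k`, the family `Y_{k,l}`, indexed by `d_k = dim SH^k` indices `l`, is an orthonormal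
basis of `SH^k` for the scalar product of `L²(𝕊ⁿ⁻¹)`. -/
structure IsHarmonicONB (n : ℕ)
    (Y : (k : ℕ) → Fin (Module.finrank ℝ (SH n k)) → Sph n → ℝ) : Prop where
  span_eq : ∀ k, Submodule.span ℝ (Set.range (Y k)) = SH n k
  normalized : ∀ k l, ∫ y, Y k l y * Y k l y ∂(surf n) = 1
  orthogonal : ∀ k l l', l ≠ l' → ∫ y, Y k l y * Y k l' y ∂(surf n) = 0

section Operators

variable {n : ℕ} (Y : (k : ℕ) → Fin (Module.finrank ℝ (SH n k)) → Sph n → ℝ)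

/-- The coefficients `c_{k,l}(u) = ∫ u Y_{k,l}`. -/
def coeff (u : Sph n → ℝ) (k : ℕ) (l : Fin (Module.finrank ℝ (SH n k))) : ℝ :=
  ∫ y, u y * Y k l y ∂(surf n)

/-- The orthogonal projector `P_k u = ∑_l c_{k,l}(u) Y_{k,l}` onto `SH^k`. -/
def proj (k : ℕ) (u : Sph n → ℝ) (x : Sph n) : ℝ := ∑ l, coeff Y u k l * Y k l x

/-- The Dirichlet-to-Neumann operator `L` acts as multiplication by `k` on `SH^k`, so `φ(L)` is
`φ(L) u = ∑_k φ(k) P_k u`. The choice `φ(k) = k` is `L` itself. -/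
def dtnCalculus (φ : ℝ → ℝ) (u : Sph n → ℝ) (x : Sph n) : ℝ := ∑' k : ℕ, φ k * proj Y k u x

/-- The semigroup `e^{-tL} u = ∑_k e^{-tk} P_k u`. -/
def dtnSemigroup (t : ℝ) (u : Sph n → ℝ) (x : Sph n) : ℝ :=
  dtnCalculus Y (fun lam => Real.exp (-t * lam)) u x

end Operators

/-! ### Bessel functions -/

/-- The modified Bessel function of the first kind `I_ρ(z)`, for `z > 0`
(with `1/Γ = 0` at the poles of `Γ`). -/
def besselI (ρ z : ℝ) : ℝ :=
  ∑' m : ℕ, (z / 2) ^ (2 * (m : ℝ) + ρ) / (Real.Gamma ((m : ℝ) + 1) * Real.Gamma ((m : ℝ) + ρ + 1))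

/-- `B_ρ(z)`: the function `I_ρ(z)` minus the first term of its series. -/
def besselB (ρ z : ℝ) : ℝ := besselI ρ z - (z / 2) ^ ρ / Real.Gamma (ρ + 1)

theorem summable_besselI (ρ : ℝ) {z : ℝ} (hz : 0 < z) :
    Summable fun m : ℕ => (z / 2) ^ (2 * (m : ℝ) + ρ) /
      (Real.Gamma ((m : ℝ) + 1) * Real.Gamma ((m : ℝ) + ρ + 1)) := by
  have hz2 : 0 < z / 2 := by positivity
  refine summable_of_ratio_norm_eventually_le (r := 1 / 2) (by norm_num) ?_
  obtain ⟨N, hN⟩ := exists_nat_gt (|ρ| + 2 * (z / 2) ^ 2 + 1)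
  filter_upwards [Filter.eventually_ge_atTop N] with m hm
  have hmN : (N : ℝ) ≤ m := by exact_mod_cast hm
  have hρ := neg_abs_le ρ
  have hsq : 0 < (z / 2) ^ 2 := by positivity
  have h1 : 0 < (m : ℝ) + ρ + 1 := by linarith
  have h2 : (0 : ℝ) < (m : ℝ) + 1 := by positivity
  have e1 : Real.Gamma (((m + 1 : ℕ) : ℝ) + 1) = ((m : ℝ) + 1) * Real.Gamma ((m : ℝ) + 1) := by
    push_cast
    exact Real.Gamma_add_one h2.ne'
  have e2 : Real.Gamma (((m + 1 : ℕ) : ℝ) + ρ + 1)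
      = ((m : ℝ) + ρ + 1) * Real.Gamma ((m : ℝ) + ρ + 1) := by
    rw [← Real.Gamma_add_one h1.ne']
    push_cast
    ring_nf
  have e3 : (z / 2) ^ (2 * ((m + 1 : ℕ) : ℝ) + ρ) = (z / 2) ^ 2 * (z / 2) ^ (2 * (m : ℝ) + ρ) := by
    rw [← Real.rpow_natCast (z / 2) 2, ← Real.rpow_add hz2]
    push_cast
    ring_nf
  have g1 := Real.Gamma_pos_of_pos h1
  have g2 := Real.Gamma_pos_of_pos h2
  have hp : 0 < (z / 2) ^ (2 * (m : ℝ) + ρ) := Real.rpow_pos_of_pos hz2 _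
  rw [e1, e2, e3, Real.norm_of_nonneg (by positivity), Real.norm_of_nonneg (by positivity)]
  have key : (z / 2) ^ 2 / (((m : ℝ) + 1) * ((m : ℝ) + ρ + 1)) ≤ 1 / 2 := by
    rw [div_le_iff₀ (by positivity)]
    have h3 : 2 * (z / 2) ^ 2 ≤ (m : ℝ) + ρ + 1 := by linarith
    nlinarith [mul_nonneg (Nat.cast_nonneg (α := ℝ) m) h1.le]
  calc _ = ((z / 2) ^ 2 / (((m : ℝ) + 1) * ((m : ℝ) + ρ + 1))) *
        ((z / 2) ^ (2 * (m : ℝ) + ρ) /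
          (Real.Gamma ((m : ℝ) + 1) * Real.Gamma ((m : ℝ) + ρ + 1))) := by
        field_simp
    _ ≤ _ := mul_le_mul_of_nonneg_right key (by positivity)

/-- The series of `B_ρ` starts at `m = 1`. -/
theorem besselB_eq_tsum (ρ : ℝ) {z : ℝ} (hz : 0 < z) :
    besselB ρ z = ∑' m : ℕ, (z / 2) ^ (2 * ((m + 1 : ℕ) : ℝ) + ρ) /
      (Real.Gamma (((m + 1 : ℕ) : ℝ) + 1) * Real.Gamma (((m + 1 : ℕ) : ℝ) + ρ + 1)) := by
  rw [besselB, besselI, (summable_besselI ρ hz).tsum_eq_zero_add]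
  simp

/-! ### The Poisson kernel, the operator `S^s` and its kernel -/

/-- The Poisson kernel `P_r(τ) = (1 - r²) / (ω_{n-1} (1 - 2 r τ + r²)^{n/2})`. -/
def poissonKer (n : ℕ) (r τ : ℝ) : ℝ :=
  (1 - r ^ 2) / (sphereArea n * (1 - 2 * r * τ + r ^ 2) ^ ((n : ℝ) / 2))

/-- The constant `(n-2)^{s+1/2} / (π^{-1/2} Γ(-s))`. -/
def fracConst (n : ℕ) (s : ℝ) : ℝ :=
  ((n : ℝ) - 2) ^ (s + 1 / 2) / (Real.pi ^ (-(1 / 2) : ℝ) * Real.Gamma (-s))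

/-- The integrand in the definition of `S^s u(x)`, with respect to `dt`. -/
def fracOpIntegrand {n : ℕ} (Y : (k : ℕ) → Fin (Module.finrank ℝ (SH n k)) → Sph n → ℝ)
    (s : ℝ) (u : Sph n → ℝ) (x : Sph n) (t : ℝ) : ℝ :=
  Real.exp (-t * (((n : ℝ) - 2) / 2)) * dtnSemigroup Y t u x *
    besselB (-s - 1 / 2) (((n : ℝ) - 2) / 2 * t) / t ^ (1 / 2 + s)

/-- The operator `S^s`. -/
def fracOp {n : ℕ} (Y : (k : ℕ) → Fin (Module.finrank ℝ (SH n k)) → Sph n → ℝ)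
    (s : ℝ) (u : Sph n → ℝ) (x : Sph n) : ℝ :=
  fracConst n s * ∫ t in Ioi (0 : ℝ), fracOpIntegrand Y s u x t

/-- The integrand in the definition of the kernel `S_s(τ)`, with respect to `dt`. -/
def fracKerIntegrand (n : ℕ) (s τ t : ℝ) : ℝ :=
  Real.exp (-t * (((n : ℝ) - 2) / 2)) * poissonKer n (Real.exp (-t)) τ *
    besselB (-s - 1 / 2) (((n : ℝ) - 2) / 2 * t) / t ^ (1 / 2 + s)

/-- The kernel `S_s(τ)`. -/
def fracKer (n : ℕ) (s τ : ℝ) : ℝ :=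
  fracConst n s * ∫ t in Ioi (0 : ℝ), fracKerIntegrand n s τ t

end SphereFrac

end

namespace SphereFrac

/-! ### The weight in the time variable -/

/-! Everything rests on writing both integrands as the weight `timeWeight`, w(t) = e^{-at}
B_{-s-1/2}(at) t^{-1/2-s} with a = (n-2)/2, times a Poisson integral or a Poisson kernel. The weight
is nonnegative, is O(t^{1-2s}) near 0 (`exists_timeWeight_le`) and is integrable on (0,∞)
(`integrableOn_timeWeight`).

Kernel estimate (`exists_integral_fracKerIntegrand_le`): for t ≤ 4 the Poisson kernel at r = e^{-t},
τ = cos θ is bounded by a multiple of t/θ^n and of t/t^n. Splitting the time integral at t = θ, both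
pieces of t^{1-2s}·t/max(t,θ)^n integrate to a multiple of θ^{3-2s-n}, which is the claimed power;
large times contribute a bounded amount.

Convolution formula: e^{-tL}u is the Poisson integral of u at radius e^{-t} (`poissonOp_eq_tsum`).
The Poisson formula, proved by the maximum principle, makes spherical harmonics of degree k
eigenfunctions with eigenvalue r^k. Symmetry of the kernel then gives orthogonality between degrees,
so the identity holds on finite sums of harmonics. Polynomials restrict to such sums and are dense
in C(𝕊ⁿ⁻¹), and both sides are continuous for the sup norm. Since the Poisson kernel is positive of
mass 1 and w is integrable, Fubini applies (`integrable_timeWeight_mul_poissonKer`) and exchanging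
the integrals gives the formula. -/

theorem integrable_of_hasSum_of_summable_integral_norm {α : Type*} [MeasurableSpace α]
    {μ : Measure α} {F : ℕ → α → ℝ} {f : α → ℝ} (hF : ∀ i, Integrable (F i) μ)
    (hs : Summable fun i => ∫ a, ‖F i a‖ ∂μ) (hf : ∀ᵐ a ∂μ, HasSum (fun i => F i a) (f a)) :
    Integrable f μ := by
  refine ⟨?_, ?_⟩
  · refine aestronglyMeasurable_of_tendsto_ae (u := Filter.atTop)
      (f := fun (N : ℕ) a => ∑ i ∈ Finset.range N, F i a) (fun N => ?_) ?_
    · exact (integrable_finsetSum _ fun i _ => hF i).1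
    · filter_upwards [hf] with a ha using ha.tendsto_sum_nat
  · have h1 : ∫⁻ a, ‖f a‖ₑ ∂μ ≤ ∫⁻ a, ∑' i, ‖F i a‖ₑ ∂μ := by
      refine lintegral_mono_ae ?_
      filter_upwards [hf] with a ha
      rw [← ha.tsum_eq]
      exact enorm_tsum_le_tsum_enorm
    refine h1.trans_lt ?_
    rw [lintegral_tsum fun i => (hF i).1.enorm]
    have h2 : ∀ i, ∫⁻ a, ‖F i a‖ₑ ∂μ = ENNReal.ofReal (∫ a, ‖F i a‖ ∂μ) := fun i =>
      (ofReal_integral_norm_eq_lintegral_enorm (hF i)).symm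
    simp_rw [h2]
    rw [← ENNReal.ofReal_tsum_of_nonneg (fun i => integral_nonneg fun a => norm_nonneg _) hs]
    exact ENNReal.ofReal_lt_top

/-- The weight `e^{-at} B_{-s-1/2}(at) t^{-1/2-s}`, `a = (n-2)/2`. -/
noncomputable def timeWeight (n : ℕ) (s t : ℝ) : ℝ :=
  Real.exp (-t * (((n : ℝ) - 2) / 2)) *
    besselB (-s - 1 / 2) (((n : ℝ) - 2) / 2 * t) / t ^ (1 / 2 + s)

theorem summable_besselB (ρ : ℝ) {z : ℝ} (hz : 0 < z) :
    Summable fun m : ℕ => (z / 2) ^ (2 * ((m + 1 : ℕ) : ℝ) + ρ) /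
      (Real.Gamma (((m + 1 : ℕ) : ℝ) + 1) * Real.Gamma (((m + 1 : ℕ) : ℝ) + ρ + 1)) :=
  (summable_nat_add_iff 1).2 (summable_besselI ρ hz)

/-- Once the first term is removed, all Gamma arguments are positive as soon as ρ > -2. This covers
ρ = -s-1/2, where Γ(ρ+1) can be negative or have a pole. -/
theorem besselB_nonneg {ρ z : ℝ} (hρ : -2 < ρ) (hz : 0 < z) : 0 ≤ besselB ρ z := by
  rw [besselB_eq_tsum ρ hz]
  refine tsum_nonneg fun m => ?_
  have h1 : 0 < Real.Gamma (((m + 1 : ℕ) : ℝ) + 1) := Real.Gamma_pos_of_pos (by positivity)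
  have h2 : 0 < Real.Gamma (((m + 1 : ℕ) : ℝ) + ρ + 1) :=
    Real.Gamma_pos_of_pos (by push_cast; linarith [(Nat.cast_nonneg m : (0 : ℝ) ≤ m)])
  positivity

/-- `B_ρ(z) / z^{ρ+2}` is nondecreasing. -/
theorem besselB_le_of_le {ρ z w : ℝ} (hρ : -2 < ρ) (hz : 0 < z) (hzw : z ≤ w) :
    besselB ρ z ≤ (z / w) ^ (ρ + 2) * besselB ρ w := by
  have hw : 0 < w := hz.trans_le hzw
  rw [besselB_eq_tsum ρ hz, besselB_eq_tsum ρ hw, ← tsum_mul_left]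
  refine (summable_besselB ρ hz).tsum_le_tsum (fun m => ?_) ((summable_besselB ρ hw).mul_left _)
  have h1 : 0 < Real.Gamma (((m + 1 : ℕ) : ℝ) + 1) := Real.Gamma_pos_of_pos (by positivity)
  have h2 : 0 < Real.Gamma (((m + 1 : ℕ) : ℝ) + ρ + 1) :=
    Real.Gamma_pos_of_pos (by push_cast; linarith [(Nat.cast_nonneg m : (0 : ℝ) ≤ m)])
  rw [← mul_div_assoc]
  refine div_le_div_of_nonneg_right ?_ (by positivity)
  have e1 : z / 2 = (z / w) * (w / 2) := by field_simp
  rw [e1, Real.mul_rpow (by positivity) (by positivity)]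
  refine mul_le_mul_of_nonneg_right ?_ (by positivity)
  -- Since z/w ≤ 1 and every exponent 2(m+1)+ρ is at least ρ+2, the power with the smallest exponent
  -- dominates term by term.
  exact Real.rpow_le_rpow_of_exponent_ge (by positivity) ((div_le_one hw).2 hzw)
    (by push_cast; linarith [(Nat.cast_nonneg m : (0 : ℝ) ≤ m)])

theorem timeWeight_nonneg {n : ℕ} (hn : 3 ≤ n) {s : ℝ} (hs1 : s < 1) {t : ℝ} (ht : 0 < t) :
    0 ≤ timeWeight n s t := by
  have hn' : (3 : ℝ) ≤ n := by exact_mod_cast hn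
  have := besselB_nonneg (ρ := -s - 1 / 2) (z := ((n : ℝ) - 2) / 2 * t) (by linarith)
    (mul_pos (by linarith) ht)
  rw [timeWeight]
  positivity

/-- The lowest surviving Bessel power is (at)^{3/2-s}; dividing by t^{1/2+s} leaves t^{1-2s}.
Comparison with the value at T supplies the constant. -/
theorem exists_timeWeight_le {n : ℕ} (hn : 3 ≤ n) {s : ℝ} (hs1 : s < 1) {T : ℝ} (hT : 0 < T) :
    ∃ C : ℝ, 0 ≤ C ∧ ∀ t, 0 < t → t ≤ T → timeWeight n s t ≤ C * t ^ (1 - 2 * s) := by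
  have hn' : (3 : ℝ) ≤ n := by exact_mod_cast hn
  have ha : 0 < ((n : ℝ) - 2) / 2 := by linarith
  set a := ((n : ℝ) - 2) / 2
  have hB := besselB_nonneg (ρ := -s - 1 / 2) (z := a * T) (by linarith) (by positivity)
  refine ⟨besselB (-s - 1 / 2) (a * T) / T ^ (3 / 2 - s), by positivity, fun t ht htT => ?_⟩
  have h1 := besselB_le_of_le (ρ := -s - 1 / 2) (z := a * t) (w := a * T) (by linarith)
    (by positivity) (by gcongr)
  have h0 := besselB_nonneg (ρ := -s - 1 / 2) (z := a * t) (by linarith) (by positivity)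
  have e1 : a * t / (a * T) = t / T := by field_simp
  have e3 : -s - 1 / 2 + 2 = 3 / 2 - s := by ring
  rw [e1, Real.div_rpow ht.le hT.le, e3] at h1
  have e2 : t ^ (1 - 2 * s) = t ^ (3 / 2 - s) / t ^ (1 / 2 + s) := by
    rw [← Real.rpow_sub ht]; ring_nf
  have h3 : Real.exp (-t * a) ≤ 1 := Real.exp_le_one_iff.2 (by nlinarith)
  rw [e2, ← mul_div_assoc]
  change Real.exp (-t * a) * besselB (-s - 1 / 2) (a * t) / _ ≤ _
  refine div_le_div_of_nonneg_right ?_ (by positivity)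
  calc _ ≤ 1 * besselB (-s - 1 / 2) (a * t) := by gcongr
    _ ≤ _ := by rw [one_mul]; exact h1.trans_eq (by ring)

/-- The series telescopes: s Γ(m+1-s)/Γ(m+2) = Γ(m+1-s)/Γ(m+1) - Γ(m+2-s)/Γ(m+2). -/
theorem summable_Gamma_sub_div_Gamma {s : ℝ} (hs0 : 0 < s) (hs1 : s < 1) :
    Summable fun m : ℕ => Real.Gamma ((m : ℝ) + 1 - s) / Real.Gamma ((m : ℝ) + 2) := by
  have hpos : ∀ m : ℕ, 0 < Real.Gamma ((m : ℝ) + 1 - s) := fun m =>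
    Real.Gamma_pos_of_pos (by linarith [(Nat.cast_nonneg m : (0 : ℝ) ≤ m)])
  have hpos1 : ∀ m : ℕ, 0 < Real.Gamma ((m : ℝ) + 1) := fun m =>
    Real.Gamma_pos_of_pos (by positivity)
  have hpos2 : ∀ m : ℕ, 0 < Real.Gamma ((m : ℝ) + 2) := fun m =>
    Real.Gamma_pos_of_pos (by positivity)
  have key : ∀ N : ℕ, s * ∑ m ∈ Finset.range N,
      Real.Gamma ((m : ℝ) + 1 - s) / Real.Gamma ((m : ℝ) + 2) =
      Real.Gamma (1 - s) - Real.Gamma ((N : ℝ) + 1 - s) / Real.Gamma ((N : ℝ) + 1) := by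
    intro N
    induction N with
    | zero => simp
    | succ m ih =>
      have h0 : (0 : ℝ) ≤ m := Nat.cast_nonneg m
      have e1 : Real.Gamma (((m + 1 : ℕ) : ℝ) + 1 - s) =
          ((m : ℝ) + 1 - s) * Real.Gamma ((m : ℝ) + 1 - s) := by
        rw [← Real.Gamma_add_one (by linarith)]; push_cast; ring_nf
      have e2 : Real.Gamma ((m : ℝ) + 2) = ((m : ℝ) + 1) * Real.Gamma ((m : ℝ) + 1) := by
        rw [← Real.Gamma_add_one (by positivity)]; ring_nf
      have e3 : Real.Gamma (((m + 1 : ℕ) : ℝ) + 1) = Real.Gamma ((m : ℝ) + 2) := by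
        push_cast; ring_nf
      rw [Finset.sum_range_succ, mul_add, ih, e1, e3, e2]
      have := (hpos1 m).ne'
      field_simp
      ring
  refine summable_of_sum_range_le (c := Real.Gamma (1 - s) / s)
    (fun m => (div_pos (hpos m) (hpos2 m)).le) fun N => ?_
  rw [le_div_iff₀ hs0, mul_comm, key]
  linarith [div_pos (hpos N) (hpos1 N)]

/-- At infinity e^{-at} only cancels the growth of the Bessel function, leaving a decay of order
t^{-1-s}. Instead of using asymptotics, the positive series is integrated term by term, which
reduces the claim to a summable ratio of Gamma values. -/
theorem integrableOn_timeWeight {n : ℕ} (hn : 3 ≤ n) {s : ℝ} (hs0 : 0 < s) (hs1 : s < 1) :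
    IntegrableOn (timeWeight n s) (Ioi 0) := by
  have hn' : (3 : ℝ) ≤ n := by exact_mod_cast hn
  have ha : 0 < ((n : ℝ) - 2) / 2 := by linarith
  set a := ((n : ℝ) - 2) / 2 with ha_def
  have hm0 : ∀ m : ℕ, (0 : ℝ) ≤ m := fun m => Nat.cast_nonneg m
  have hg1 : ∀ m : ℕ, 0 < Real.Gamma ((m : ℝ) + 2) := fun m =>
    Real.Gamma_pos_of_pos (by positivity)
  have hg2 : ∀ m : ℕ, 0 < Real.Gamma ((m : ℝ) + 3 / 2 - s) := fun m =>
    Real.Gamma_pos_of_pos (by linarith [hm0 m])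
  set K : ℕ → ℝ := fun m => (a / 2) ^ (2 * (m : ℝ) + 3 / 2 - s) /
    (Real.Gamma ((m : ℝ) + 2) * Real.Gamma ((m : ℝ) + 3 / 2 - s)) with hK
  have hKpos : ∀ m, 0 < K m := fun m => by
    have := hg1 m; have := hg2 m
    simp only [hK]; positivity
  set F : ℕ → ℝ → ℝ := fun m t =>
    K m * (t ^ ((2 * (m : ℝ) + 2 - 2 * s) - 1) * Real.exp (-(a * t))) with hF
  have hb : ∀ m : ℕ, 0 < 2 * (m : ℝ) + 2 - 2 * s := fun m => by linarith [hm0 m]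
  have hFint : ∀ m, IntegrableOn (F m) (Ioi 0) := fun m => by
    refine Integrable.const_mul ?_ _
    have := integrableOn_rpow_mul_exp_neg_mul_rpow (p := 1) (b := a)
      (s := (2 * (m : ℝ) + 2 - 2 * s) - 1) (by linarith [hb m]) one_pos ha
    simpa [IntegrableOn] using this
  refine integrable_of_hasSum_of_summable_integral_norm (F := F) hFint ?_ ?_
  · have e : ∀ m, ∫ t in Ioi (0 : ℝ), ‖F m t‖ = a ^ (s - 1 / 2) * 2 ^ (-(1 / 2) - s) / √Real.pi *
        (Real.Gamma ((m : ℝ) + 1 - s) / Real.Gamma ((m : ℝ) + 2)) := by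
      intro m
      have e1 : ∫ t in Ioi (0 : ℝ), ‖F m t‖ = ∫ t in Ioi (0 : ℝ), F m t := by
        refine setIntegral_congr_fun measurableSet_Ioi fun t ht => ?_
        have ht' : (0 : ℝ) < t := ht
        have := hKpos m
        exact Real.norm_of_nonneg (by positivity)
      rw [e1]
      simp only [hF]
      rw [integral_const_mul, Real.integral_rpow_mul_exp_neg_mul_Ioi (hb m) ha]
      -- Legendre duplication splits the Γ(2m+2-2s) coming from the time integral and cancels the
      -- factor Γ(m+3/2-s) of the Bessel coefficient.
      have dup := Real.Gamma_mul_Gamma_add_half ((m : ℝ) + 1 - s)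
      have r1 : (m : ℝ) + 1 - s + 1 / 2 = (m : ℝ) + 3 / 2 - s := by ring
      have r2 : 2 * ((m : ℝ) + 1 - s) = 2 * (m : ℝ) + 2 - 2 * s := by ring
      rw [r1, r2] at dup
      have hpi : 0 < √Real.pi := Real.sqrt_pos.2 Real.pi_pos
      have p1 : (0 : ℝ) < 2 ^ (1 - (2 * (m : ℝ) + 2 - 2 * s)) := by positivity
      have dup' : Real.Gamma (2 * (m : ℝ) + 2 - 2 * s) =
          Real.Gamma ((m : ℝ) + 1 - s) * Real.Gamma ((m : ℝ) + 3 / 2 - s) /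
            (2 ^ (1 - (2 * (m : ℝ) + 2 - 2 * s)) * √Real.pi) := by
        rw [dup]; field_simp
      -- The powers of a and 2 combine to a factor independent of m.
      have q1 : (a / 2) ^ (2 * (m : ℝ) + 3 / 2 - s) * (1 / a) ^ (2 * (m : ℝ) + 2 - 2 * s) /
          2 ^ (1 - (2 * (m : ℝ) + 2 - 2 * s)) = a ^ (s - 1 / 2) * 2 ^ (-(1 / 2) - s) := by
        rw [Real.div_rpow ha.le two_pos.le, one_div, Real.inv_rpow ha.le, ← Real.rpow_neg ha.le,
          div_mul_eq_mul_div, ← Real.rpow_add ha, div_div, ← Real.rpow_add two_pos,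
          div_eq_mul_inv, ← Real.rpow_neg two_pos.le]
        ring_nf
      rw [dup', ← q1]
      simp only [hK]
      have h1 := (hg1 m).ne'
      have h2 := (hg2 m).ne'
      generalize Real.Gamma ((m : ℝ) + 3 / 2 - s) = g at h2 ⊢
      field_simp
    simp_rw [e]
    exact (summable_Gamma_sub_div_Gamma hs0 hs1).mul_left _
  · refine (ae_restrict_iff' measurableSet_Ioi).2 (Filter.Eventually.of_forall fun t ht => ?_)
    have ht' : (0 : ℝ) < t := ht
    have hz : 0 < a * t := by positivity
    have hsum := (summable_besselB (-s - 1 / 2) hz).hasSum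
    rw [← besselB_eq_tsum _ hz] at hsum
    have h2 := (hsum.mul_left (Real.exp (-t * a))).div_const (t ^ (1 / 2 + s))
    refine h2.congr_fun fun m => ?_
    simp only [hF, hK]
    have e1 : ((m + 1 : ℕ) : ℝ) + 1 = (m : ℝ) + 2 := by push_cast; ring
    have e2 : ((m + 1 : ℕ) : ℝ) + (-s - 1 / 2) + 1 = (m : ℝ) + 3 / 2 - s := by push_cast; ring
    have e3 : 2 * ((m + 1 : ℕ) : ℝ) + (-s - 1 / 2) = 2 * (m : ℝ) + 3 / 2 - s := by push_cast; ring
    have e4 : a * t / 2 = a / 2 * t := by ring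
    have e5 : t ^ (2 * (m : ℝ) + 2 - 2 * s - 1) =
        t ^ (2 * (m : ℝ) + 3 / 2 - s) / t ^ (1 / 2 + s) := by
      rw [← Real.rpow_sub ht']; ring_nf
    rw [e1, e2, e3, e4, Real.mul_rpow (by positivity) ht'.le, e5]
    have e6 : -t * a = -(a * t) := by ring
    rw [e6]
    ring

/-! ### Bounds for the Poisson kernel and the kernel estimate -/

theorem sphereArea_pos {n : ℕ} (hn : 3 ≤ n) : 0 < sphereArea n := by
  have hn' : (3 : ℝ) ≤ n := by exact_mod_cast hn
  have := Real.Gamma_pos_of_pos (s := (n : ℝ) / 2) (by linarith)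
  have := Real.pi_pos
  unfold sphereArea
  positivity

theorem rpow_half_natCast_of_sq (n : ℕ) {b : ℝ} (hb : 0 ≤ b) : (b ^ 2) ^ ((n : ℝ) / 2) = b ^ n := by
  rw [← Real.rpow_natCast b 2, ← Real.rpow_mul hb, ← Real.rpow_natCast]
  congr 1
  push_cast
  ring

theorem poissonKer_nonneg {n : ℕ} (hn : 3 ≤ n) {r τ : ℝ} (hr0 : 0 ≤ r) (hr1 : r ≤ 1) (hτ : τ ≤ 1) :
    0 ≤ poissonKer n r τ := by
  have h := sphereArea_pos hn
  have h1 : 0 ≤ 1 - r ^ 2 := by nlinarith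
  have h2 : 0 ≤ 1 - 2 * r * τ + r ^ 2 := by nlinarith [sq_nonneg (1 - r)]
  unfold poissonKer
  positivity

/-- A lower bound for `1 - 2rτ + r²` gives an upper bound for the Poisson kernel. -/
theorem poissonKer_le_of_sq_le {n : ℕ} (hn : 3 ≤ n) {r τ b : ℝ} (hr0 : 0 ≤ r) (hr1 : r ≤ 1)
    (hb : 0 < b) (h : b ^ 2 ≤ 1 - 2 * r * τ + r ^ 2) :
    poissonKer n r τ ≤ (1 - r ^ 2) / (sphereArea n * b ^ n) := by
  have hω := sphereArea_pos hn
  have h1 : 0 ≤ 1 - r ^ 2 := by nlinarith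
  unfold poissonKer
  refine div_le_div_of_nonneg_left h1 (by positivity) ?_
  rw [← rpow_half_natCast_of_sq n hb.le]
  gcongr

/-- With r = e^{-t}, the identity 1 - 2r cos θ + r² = (1-r)² + 2r(1 - cos θ) bounds the denominator
below by multiples of t² and of θ². The parameter M carries both bounds with one constant. The
cutoff 4 exceeds π, so t = θ lies in this range. -/
theorem poissonKer_exp_neg_le {n : ℕ} (hn : 3 ≤ n) {t θ M : ℝ} (ht0 : 0 < t) (ht : t ≤ 4)
    (hθ0 : 0 < θ) (hθ : θ ≤ Real.pi) (hM : M = t ∨ M = θ) :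
    poissonKer n (Real.exp (-t)) (Real.cos θ) ≤
      2 * t / (sphereArea n * (Real.exp (-4) / 2) ^ n) / M ^ n := by
  have hω := sphereArea_pos hn
  have hr1 : Real.exp (-t) ≤ 1 := Real.exp_le_one_iff.2 (by linarith)
  have hr0 := Real.exp_pos (-t)
  have hκ0 := Real.exp_pos (-4)
  have hκ : Real.exp (-4) ≤ Real.exp (-t) := Real.exp_le_exp.2 (by linarith)
  have hκ1 : Real.exp (-4) ≤ 1 := hκ.trans hr1
  -- 1 - e^{-t} = e^{-t}(e^t - 1) ≥ e^{-t} t.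
  have h1 : Real.exp (-4) * t ≤ 1 - Real.exp (-t) := by
    have h := Real.add_one_le_exp t
    have h2 : Real.exp (-t) * Real.exp t = 1 := by rw [← Real.exp_add]; simp
    nlinarith
  have h2 : 1 - Real.exp (-t) ≤ t := by linarith [Real.add_one_le_exp (-t)]
  have hMpos : 0 < M := by rcases hM with rfl | rfl <;> assumption
  have hcos : θ ^ 2 / 8 ≤ 1 - Real.cos θ := by
    have h := Real.cos_le_one_sub_mul_cos_sq (x := θ) (by rw [abs_of_pos hθ0]; exact hθ)
    -- The constant 1/8 is 2/π² with π replaced by 4.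
    have h3 : (1 : ℝ) / 8 ≤ 2 / Real.pi ^ 2 := by
      rw [div_le_div_iff₀ (by norm_num) (by positivity)]
      nlinarith [Real.pi_le_four, Real.pi_pos]
    nlinarith [sq_nonneg θ]
  have key : (Real.exp (-4) / 2 * M) ^ 2 ≤
      1 - 2 * Real.exp (-t) * Real.cos θ + Real.exp (-t) ^ 2 := by
    have e : 1 - 2 * Real.exp (-t) * Real.cos θ + Real.exp (-t) ^ 2 =
      (1 - Real.exp (-t)) ^ 2 + 2 * Real.exp (-t) * (1 - Real.cos θ) := by ring
    rw [e]
    have h5 : (Real.exp (-4) * t) ^ 2 ≤ (1 - Real.exp (-t)) ^ 2 := by gcongr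
    have h6 : 2 * Real.exp (-4) * (θ ^ 2 / 8) ≤ 2 * Real.exp (-t) * (1 - Real.cos θ) := by gcongr
    have h7 : 0 ≤ 2 * Real.exp (-4) * (θ ^ 2 / 8) := by positivity
    have h8 : 0 ≤ (Real.exp (-4) * t) ^ 2 := by positivity
    rcases hM with rfl | rfl
    · nlinarith
    · have h9 : Real.exp (-4) ^ 2 * M ^ 2 ≤ Real.exp (-4) * M ^ 2 := by
        have : Real.exp (-4) ^ 2 ≤ Real.exp (-4) := by nlinarith
        gcongr
      nlinarith
  refine (poissonKer_le_of_sq_le hn hr0.le hr1 (by positivity) key).trans ?_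
  rw [mul_pow, ← mul_assoc, ← div_div]
  gcongr
  nlinarith

theorem poissonKer_exp_neg_le_of_four_le {n : ℕ} (hn : 3 ≤ n) {t τ : ℝ} (ht : 4 ≤ t)
    (hτ : τ ≤ 1) : poissonKer n (Real.exp (-t)) τ ≤ 1 / (sphereArea n * (1 / 2) ^ n) := by
  have hω := sphereArea_pos hn
  have hr0 := Real.exp_pos (-t)
  have hr1 : Real.exp (-t) ≤ 1 / 2 := by
    have h := Real.add_one_le_exp t
    rw [Real.exp_neg, inv_eq_one_div]
    exact one_div_le_one_div_of_le two_pos (by linarith)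
  refine (poissonKer_le_of_sq_le hn hr0.le (by linarith) (b := 1 / 2) (by norm_num) ?_).trans ?_
  · nlinarith
  · gcongr
    nlinarith

theorem measurable_poissonKer (n : ℕ) :
    Measurable fun p : ℝ × ℝ => poissonKer n p.1 p.2 := by
  unfold poissonKer
  fun_prop

theorem fracKerIntegrand_eq (n : ℕ) (s τ t : ℝ) :
    fracKerIntegrand n s τ t = timeWeight n s t * poissonKer n (Real.exp (-t)) τ := by
  unfold fracKerIntegrand timeWeight
  ring

theorem integrableOn_fracKerIntegrand {n : ℕ} (hn : 3 ≤ n) {s : ℝ} (hs0 : 0 < s) (hs1 : s < 1)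
    {θ : ℝ} (hθ0 : 0 < θ) (hθ : θ ≤ Real.pi) :
    IntegrableOn (fracKerIntegrand n s (Real.cos θ)) (Ioi 0) := by
  have hω := sphereArea_pos hn
  have h1 : (fracKerIntegrand n s (Real.cos θ)) =
      fun t => timeWeight n s t * poissonKer n (Real.exp (-t)) (Real.cos θ) :=
    funext fun t => fracKerIntegrand_eq n s _ t
  rw [h1]
  have hm : Measurable fun t : ℝ => poissonKer n (Real.exp (-t)) (Real.cos θ) :=
    (measurable_poissonKer n).comp (f := fun t : ℝ => (Real.exp (-t), Real.cos θ)) (by fun_prop)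
  refine Integrable.mul_bdd (c := max (2 * 4 / (sphereArea n * (Real.exp (-4) / 2) ^ n) / θ ^ n)
    (1 / (sphereArea n * (1 / 2) ^ n))) (integrableOn_timeWeight hn hs0 hs1)
    hm.aestronglyMeasurable ?_
  refine (ae_restrict_iff' measurableSet_Ioi).2 (Filter.Eventually.of_forall fun t ht => ?_)
  have ht' : (0 : ℝ) < t := ht
  rw [Real.norm_of_nonneg (poissonKer_nonneg hn (Real.exp_pos _).le
    (Real.exp_le_one_iff.2 (by linarith)) (Real.cos_le_one θ))]
  rcases le_total t 4 with h4 | h4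
  · refine le_max_of_le_left ((poissonKer_exp_neg_le hn ht' h4 hθ0 hθ (Or.inr rfl)).trans ?_)
    gcongr
  · exact le_max_of_le_right (poissonKer_exp_neg_le_of_four_le hn h4 (Real.cos_le_one θ))

/-- The time integral is cut at t = θ: below, the kernel bound with θ^n is used; above, the one with
t^n. The exponent q = n-3+2s is positive, which makes the tail converge and lets a bounded remainder
be absorbed. -/
theorem exists_integral_fracKerIntegrand_le {n : ℕ} (hn : 3 ≤ n) {s : ℝ} (hs0 : 0 < s)
    (hs1 : s < 1) :
    ∃ C : ℝ, 0 ≤ C ∧ ∀ θ, 0 < θ → θ ≤ Real.pi →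
      ∫ t in Ioi (0 : ℝ), fracKerIntegrand n s (Real.cos θ) t ≤
        C / θ ^ (((n : ℝ) - 1) - (2 - 2 * s)) := by
  have hω := sphereArea_pos hn
  have hn' : (3 : ℝ) ≤ n := by exact_mod_cast hn
  obtain ⟨C, hC0, hC⟩ := exists_timeWeight_le (n := n) hn hs1 (T := 4) (by norm_num)
  have hG := integrableOn_timeWeight hn hs0 hs1
  set q : ℝ := ((n : ℝ) - 1) - (2 - 2 * s) with hq
  have hq0 : 0 < q := by rw [hq]; linarith
  set A : ℝ := 2 / (sphereArea n * (Real.exp (-4) / 2) ^ n) with hA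
  have hA0 : 0 ≤ A := by positivity
  set M : ℝ := 1 / (sphereArea n * (1 / 2) ^ n) with hM
  have hM0 : 0 ≤ M := by positivity
  set J : ℝ := ∫ t in Ioi (0 : ℝ), timeWeight n s t with hJ
  have hJ0 : 0 ≤ J := setIntegral_nonneg measurableSet_Ioi fun t ht => timeWeight_nonneg hn hs1 ht
  refine ⟨C * A / (3 - 2 * s) + C * A / q + M * J * Real.pi ^ q, ?_, fun θ hθ0 hθ => ?_⟩
  · have : 0 < 3 - 2 * s := by linarith
    have := Real.pi_pos
    positivity
  have hint := integrableOn_fracKerIntegrand hn hs0 hs1 hθ0 hθ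
  have hθ4 : θ ≤ 4 := hθ.trans Real.pi_le_four
  have hθq : 0 < θ ^ q := by positivity
  have hθn : θ ^ n = θ ^ (n : ℝ) := (Real.rpow_natCast _ _).symm
  have near : ∀ t M', 0 < t → t ≤ 4 → (M' = t ∨ M' = θ) →
      fracKerIntegrand n s (Real.cos θ) t ≤ C * A * (t ^ (2 - 2 * s) / M' ^ n) := by
    intro t M' ht0 ht4 hM'
    have hM'0 : 0 < M' := by rcases hM' with rfl | rfl <;> assumption
    rw [fracKerIntegrand_eq]
    have e : t ^ (2 - 2 * s) = t ^ (1 - 2 * s) * t := by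
      rw [← Real.rpow_add_one ht0.ne']; ring_nf
    calc _ ≤ (C * t ^ (1 - 2 * s)) * (2 * t / (sphereArea n * (Real.exp (-4) / 2) ^ n) / M' ^ n) :=
          mul_le_mul (hC t ht0 ht4) (poissonKer_exp_neg_le hn ht0 ht4 hθ0 hθ hM')
            (poissonKer_nonneg hn (Real.exp_pos _).le (Real.exp_le_one_iff.2 (by linarith))
              (Real.cos_le_one θ)) (by positivity)
      _ = _ := by rw [e, hA]; ring
  have b1 : ∫ t in Ioc 0 θ, fracKerIntegrand n s (Real.cos θ) t ≤
      C * A / (3 - 2 * s) / θ ^ q := by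
    have hI : IntervalIntegrable (fun t : ℝ => t ^ (2 - 2 * s)) volume 0 θ :=
      intervalIntegral.intervalIntegrable_rpow' (by linarith)
    have hI' : IntegrableOn (fun t : ℝ => t ^ (2 - 2 * s)) (Ioc 0 θ) :=
      (intervalIntegrable_iff_integrableOn_Ioc_of_le hθ0.le).1 hI
    calc _ ≤ ∫ t in Ioc 0 θ, C * A * (t ^ (2 - 2 * s) / θ ^ n) :=
          setIntegral_mono_on (hint.mono_set Ioc_subset_Ioi_self)
            ((hI'.div_const _).const_mul _) measurableSet_Ioc
            fun t ht => near t θ ht.1 (ht.2.trans hθ4) (Or.inr rfl)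
      _ = C * A * ((θ ^ (3 - 2 * s) / (3 - 2 * s)) / θ ^ n) := by
          rw [integral_const_mul, integral_div, ← intervalIntegral.integral_of_le hθ0.le,
            integral_rpow (Or.inl (by linarith)),
            show (2 - 2 * s + 1) = 3 - 2 * s by ring,
            Real.zero_rpow (by linarith : (3 - 2 * s) ≠ 0), sub_zero]
      _ = _ := by
          have e : θ ^ (3 - 2 * s) / θ ^ n = 1 / θ ^ q := by
            rw [hθn, ← Real.rpow_sub hθ0, one_div, ← Real.rpow_neg hθ0.le, hq]
            ring_nf
          calc _ = C * A / (3 - 2 * s) * (θ ^ (3 - 2 * s) / θ ^ n) := by ring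
            _ = _ := by rw [e]; ring
  have b2 : ∫ t in Ioi θ, fracKerIntegrand n s (Real.cos θ) t ≤
      C * A / q / θ ^ q + M * J := by
    have hI' : IntegrableOn (fun t : ℝ => t ^ (-q - 1)) (Ioi θ) :=
      integrableOn_Ioi_rpow_of_lt (by linarith) hθ0
    have hGθ : IntegrableOn (timeWeight n s) (Ioi θ) := hG.mono_set (Ioi_subset_Ioi hθ0.le)
    -- Adding the majorants for t ≤ 4 and t ≥ 4, both nonnegative, avoids cutting the integral again
    -- at 4.
    have hle : ∀ t ∈ Ioi θ, fracKerIntegrand n s (Real.cos θ) t ≤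
        C * A * t ^ (-q - 1) + M * timeWeight n s t := by
      intro t ht
      have ht0 : 0 < t := hθ0.trans ht
      have hG0 := timeWeight_nonneg hn hs1 ht0
      rcases le_total t 4 with h4 | h4
      · have h := near t t ht0 h4 (Or.inl rfl)
        have e : t ^ (2 - 2 * s) / t ^ n = t ^ (-q - 1) := by
          rw [← Real.rpow_natCast, ← Real.rpow_sub ht0, hq]
          ring_nf
        rw [e] at h
        have := mul_nonneg hM0 hG0
        linarith
      · rw [fracKerIntegrand_eq, mul_comm]
        have h := mul_le_mul_of_nonneg_right
          (poissonKer_exp_neg_le_of_four_le hn h4 (Real.cos_le_one θ)) hG0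
        have h' : 0 ≤ C * A * t ^ (-q - 1) := by positivity
        linarith
    calc _ ≤ ∫ t in Ioi θ, (C * A * t ^ (-q - 1) + M * timeWeight n s t) :=
          setIntegral_mono_on (hint.mono_set (Ioi_subset_Ioi hθ0.le))
            ((hI'.const_mul _).add (hGθ.const_mul _)) measurableSet_Ioi hle
      _ = C * A * (1 / q / θ ^ q) + M * ∫ t in Ioi θ, timeWeight n s t := by
          rw [integral_add (hI'.const_mul _) (hGθ.const_mul _), integral_const_mul,
            integral_const_mul, integral_Ioi_rpow_of_lt (by linarith) hθ0, sub_add_cancel,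
            Real.rpow_neg hθ0.le]
          field_simp
      _ ≤ C * A * (1 / q / θ ^ q) + M * J := by
          gcongr
          refine setIntegral_mono_set hG ?_ (Ioi_subset_Ioi hθ0.le).eventuallyLE
          exact (ae_restrict_iff' measurableSet_Ioi).2
            (Filter.Eventually.of_forall fun t ht => timeWeight_nonneg hn hs1 ht)
      _ = _ := by ring
  have hsplit : ∫ t in Ioi (0 : ℝ), fracKerIntegrand n s (Real.cos θ) t =
      (∫ t in Ioc 0 θ, fracKerIntegrand n s (Real.cos θ) t) +
        ∫ t in Ioi θ, fracKerIntegrand n s (Real.cos θ) t := by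
    rw [← Ioc_union_Ioi_eq_Ioi hθ0.le]
    exact setIntegral_union (Set.disjoint_left.2 fun t h1 h2 => not_lt.2 h1.2 h2) measurableSet_Ioi
      (hint.mono_set Ioc_subset_Ioi_self) (hint.mono_set (Ioi_subset_Ioi hθ0.le))
  -- As θ ≤ π and q > 0, the bounded contribution of large times is absorbed into the singular
  -- power.
  have hπ : M * J ≤ M * J * Real.pi ^ q / θ ^ q := by
    rw [le_div_iff₀ hθq]
    gcongr
  rw [hsplit, add_div, add_div]
  linarith

/-! ### Inner product and geodesic distance on the sphere -/

theorem dot_mem_Icc {n : ℕ} (x y : Sph n) : dot x y ∈ Icc (-1 : ℝ) 1 := by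
  have h := abs_real_inner_le_norm (x : E n) (y : E n)
  rw [norm_eq_of_mem_sphere x, norm_eq_of_mem_sphere y, mul_one] at h
  exact abs_le.1 h

theorem dot_lt_one {n : ℕ} {x y : Sph n} (h : x ≠ y) : dot x y < 1 := by
  refine lt_of_le_of_ne (dot_mem_Icc x y).2 fun h1 => h (Subtype.ext ?_)
  exact (inner_eq_one_iff_of_norm_eq_one (norm_eq_of_mem_sphere x) (norm_eq_of_mem_sphere y)).1 h1

theorem cos_geoDist {n : ℕ} (x y : Sph n) : Real.cos (geoDist x y) = dot x y :=
  Real.cos_arccos (dot_mem_Icc x y).1 (dot_mem_Icc x y).2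

theorem geoDist_pos {n : ℕ} {x y : Sph n} (h : x ≠ y) : 0 < geoDist x y :=
  Real.arccos_pos.2 (dot_lt_one h)

theorem integrableOn_fracKerIntegrand_dot {n : ℕ} (hn : 3 ≤ n) {s : ℝ} (hs0 : 0 < s) (hs1 : s < 1)
    {x y : Sph n} (h : x ≠ y) : IntegrableOn (fracKerIntegrand n s (dot x y)) (Ioi 0) := by
  rw [← cos_geoDist]
  exact integrableOn_fracKerIntegrand hn hs0 hs1 (geoDist_pos h) (Real.arccos_le_pi _)

theorem exists_abs_fracKer_le {n : ℕ} (hn : 3 ≤ n) {s : ℝ} (hs0 : 0 < s) (hs1 : s < 1) :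
    ∃ c : ℝ, 0 < c ∧ ∀ x y : Sph n, x ≠ y →
      |fracKer n s (dot x y)| ≤ c / geoDist x y ^ (((n : ℝ) - 1) - (2 - 2 * s)) := by
  obtain ⟨C, hC0, hC⟩ := exists_integral_fracKerIntegrand_le hn hs0 hs1
  -- The summand 1 secures strict positivity, since C is only known to be nonnegative.
  refine ⟨|fracConst n s| * C + 1, by positivity, fun x y hxy => ?_⟩
  have hθ := geoDist_pos hxy
  have h := hC _ hθ (Real.arccos_le_pi _)
  rw [cos_geoDist] at h
  have h0 : 0 ≤ ∫ t in Ioi (0 : ℝ), fracKerIntegrand n s (dot x y) t := by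
    refine setIntegral_nonneg measurableSet_Ioi fun t ht => ?_
    rw [fracKerIntegrand_eq]
    exact mul_nonneg (timeWeight_nonneg hn hs1 ht) (poissonKer_nonneg hn (Real.exp_pos _).le
      (Real.exp_le_one_iff.2 (by linarith [mem_Ioi.1 ht])) (dot_mem_Icc x y).2)
  rw [fracKer, abs_mul, abs_of_nonneg h0]
  calc _ ≤ |fracConst n s| * (C / geoDist x y ^ (((n : ℝ) - 1) - (2 - 2 * s))) := by gcongr
    _ ≤ _ := by
      rw [← mul_div_assoc]
      gcongr
      linarith

/-! ### The surface measure -/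

instance isFiniteMeasure_surf (n : ℕ) : IsFiniteMeasure (surf n) := by
  unfold surf; infer_instance

theorem surf_real_univ {n : ℕ} (hn : 3 ≤ n) : (surf n).real univ = sphereArea n := by
  have : Nonempty (Fin n) := ⟨⟨0, by omega⟩⟩
  have hn0 : (0 : ℝ) < n := by exact_mod_cast (by omega : 0 < n)
  have hg : 0 < Real.Gamma ((n : ℝ) / 2 + 1) := Real.Gamma_pos_of_pos (by positivity)
  rw [surf, Measure.toSphere_real_apply_univ, finrank_euclideanSpace, Fintype.card_fin,
    Measure.real, EuclideanSpace.volume_ball, Fintype.card_fin, ENNReal.ofReal_one, one_pow,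
    one_mul, ENNReal.toReal_ofReal (by positivity), Real.Gamma_add_one (by positivity), sphereArea,
    Real.sqrt_eq_rpow, ← Real.rpow_natCast, ← Real.rpow_mul Real.pi_pos.le]
  have : (1 : ℝ) / 2 * n = n / 2 := by ring
  rw [this]
  field_simp

/-- The action of a linear isometry on the sphere. -/
noncomputable def sphereMap {n : ℕ} (e : E n ≃ₗᵢ[ℝ] E n) (y : Sph n) : Sph n :=
  ⟨e y, by simp⟩

theorem continuous_sphereMap {n : ℕ} (e : E n ≃ₗᵢ[ℝ] E n) : Continuous (sphereMap e) :=
  Continuous.subtype_mk (e.continuous.comp continuous_subtype_val) _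

-- The surface measure of A is a multiple of the volume of the cone (0,1)·A; a linear isometry maps
-- cones to cones and preserves volume.
open scoped Pointwise in
theorem measurePreserving_sphereMap {n : ℕ} (e : E n ≃ₗᵢ[ℝ] E n) :
    MeasurePreserving (sphereMap e) (surf n) (surf n) := by
  refine ⟨(continuous_sphereMap e).measurable, ?_⟩
  ext s hs
  have hm := (continuous_sphereMap e).measurable hs
  have hvol : volume (Ioo (0 : ℝ) 1 • (Subtype.val '' s : Set (E n))) =
      volume (e.toMeasurableEquiv ⁻¹' (Ioo (0 : ℝ) 1 • (Subtype.val '' s : Set (E n)))) :=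
    (e.measurePreserving.measure_preimage_equiv (f := e.toMeasurableEquiv) _).symm
  rw [Measure.map_apply (continuous_sphereMap e).measurable hs, surf,
    Measure.toSphere_apply' _ hs, Measure.toSphere_apply' _ hm, hvol]
  congr 2
  ext X
  simp only [mem_smul, mem_image, mem_preimage]
  constructor
  · rintro ⟨r, hr, _, ⟨y, hy, rfl⟩, rfl⟩
    exact ⟨r, hr, _, ⟨_, hy, rfl⟩, by simp [sphereMap]⟩
  · rintro ⟨r, hr, _, ⟨y, hy, rfl⟩, h⟩
    refine ⟨r, hr, _, ⟨sphereMap e.symm y, ?_, rfl⟩, ?_⟩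
    · convert hy
      simp [sphereMap]
    · have h' : X = e.symm (r • (y : E n)) := by
        rw [h]; exact (e.symm_apply_apply X).symm
      rw [h', map_smul]
      rfl

theorem integral_sphereMap {n : ℕ} (e : E n ≃ₗᵢ[ℝ] E n) {f : Sph n → ℝ} (hf : Continuous f) :
    ∫ y, f (sphereMap e y) ∂(surf n) = ∫ y, f y ∂(surf n) := by
  have h := measurePreserving_sphereMap e
  rw [← integral_map (φ := sphereMap e) h.measurable.aemeasurable hf.aestronglyMeasurable, h.map_eq]

theorem integrable_surf_of_continuous {n : ℕ} {f : Sph n → ℝ} (hf : Continuous f) :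
    Integrable f (surf n) :=
  hf.integrable_of_hasCompactSupport (HasCompactSupport.of_compactSpace f)

/-! ### The Laplacian along coordinate lines and the maximum principle -/

/-- `u` is twice differentiable at `X` along the coordinate directions, with second derivatives
of sum `v`. -/
def HasLineLaplacianAt {n : ℕ} (u : E n → ℝ) (v : ℝ) (X : E n) : Prop :=
  ∃ (u' : Fin n → ℝ → ℝ) (u'' : Fin n → ℝ),
    (∀ i, ∀ᶠ t in nhds (0 : ℝ),
      HasDerivAt (fun t : ℝ => u (X + t • EuclideanSpace.single i 1)) (u' i t) t) ∧
    (∀ i, HasDerivAt (u' i) (u'' i) 0) ∧ ∑ i, u'' i = v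

theorem HasLineLaplacianAt.add {n : ℕ} {u w : E n → ℝ} {a b : ℝ} {X : E n}
    (hu : HasLineLaplacianAt u a X) (hw : HasLineLaplacianAt w b X) :
    HasLineLaplacianAt (fun X => u X + w X) (a + b) X := by
  obtain ⟨u', u'', h1, h2, h3⟩ := hu
  obtain ⟨w', w'', k1, k2, k3⟩ := hw
  refine ⟨fun i t => u' i t + w' i t, fun i => u'' i + w'' i, fun i => ?_,
    fun i => (h2 i).add (k2 i), by rw [Finset.sum_add_distrib, h3, k3]⟩
  filter_upwards [h1 i, k1 i] with t ht kt using ht.add kt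

theorem HasLineLaplacianAt.const_mul {n : ℕ} {u : E n → ℝ} {a : ℝ} {X : E n}
    (hu : HasLineLaplacianAt u a X) (c : ℝ) :
    HasLineLaplacianAt (fun X => c * u X) (c * a) X := by
  obtain ⟨u', u'', h1, h2, h3⟩ := hu
  refine ⟨fun i t => c * u' i t, fun i => c * u'' i, fun i => ?_,
    fun i => (h2 i).const_mul c, by rw [← Finset.mul_sum, h3]⟩
  filter_upwards [h1 i] with t ht using ht.const_mul c

theorem norm_add_smul_single_sq {n : ℕ} (X : E n) (i : Fin n) (t : ℝ) :
    ‖X + t • (EuclideanSpace.single i 1 : E n)‖ ^ 2 = ‖X‖ ^ 2 + 2 * t * X i + t ^ 2 := by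
  rw [norm_add_sq_real, inner_smul_right, norm_smul, EuclideanSpace.inner_single_right]
  simp
  ring

theorem hasLineLaplacianAt_norm_sq {n : ℕ} (X : E n) :
    HasLineLaplacianAt (fun X => ‖X‖ ^ 2) (2 * n) X := by
  refine ⟨fun i t => 2 * X i + 2 * t, fun i => 2, fun i => Filter.Eventually.of_forall fun t => ?_,
    fun i => ?_, by simp [mul_comm]⟩
  · simp_rw [norm_add_smul_single_sq]
    have h := (((hasDerivAt_id t).const_mul (2 * X i)).add ((hasDerivAt_id t).pow 2)).const_add
      (‖X‖ ^ 2)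
    refine (h.congr_deriv (by simp)).congr_of_eventuallyEq
      (Filter.Eventually.of_forall fun t => ?_)
    simp
    ring
  · simpa using ((hasDerivAt_id (0 : ℝ)).const_mul 2).const_add (2 * X i)

/-- If the second derivative were positive, x would also be a local minimum, so f would be locally
constant and its second derivative would vanish. -/
theorem IsLocalMax.second_deriv_nonpos {f f' : ℝ → ℝ} {x f'' : ℝ} (hmax : IsLocalMax f x)
    (hf : ∀ᶠ t in nhds x, HasDerivAt f (f' t) t) (hf' : HasDerivAt f' f'' x) : f'' ≤ 0 := by
  by_contra! hpos
  have e1 : deriv f =ᶠ[nhds x] f' := hf.mono fun t ht => ht.deriv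
  have e2 : deriv (deriv f) x = f'' := by rw [e1.deriv_eq, hf'.deriv]
  have hmin := isLocalMin_of_deriv_deriv_pos (by rw [e2]; exact hpos) hmax.deriv_eq_zero
    hf.self_of_nhds.continuousAt
  have hconst : f =ᶠ[nhds x] fun _ => f x := by
    filter_upwards [hmax, hmin] with t h1 h2 using le_antisymm h1 h2
  have e3 : deriv f =ᶠ[nhds x] fun _ => 0 := by
    refine hconst.deriv.trans (Filter.Eventually.of_forall fun t => ?_)
    simp
  rw [e3.deriv_eq] at e2
  simp at e2
  exact hpos.ne e2

theorem IsLocalMax.lineLaplacian_nonpos {n : ℕ} {u : E n → ℝ} {v : ℝ} {X : E n}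
    (hmax : IsLocalMax u X) (hu : HasLineLaplacianAt u v X) : v ≤ 0 := by
  obtain ⟨u', u'', h1, h2, rfl⟩ := hu
  refine Finset.sum_nonpos fun i _ => ?_
  refine IsLocalMax.second_deriv_nonpos ?_ (h1 i) (h2 i)
  have hc : ContinuousAt (fun t : ℝ => X + t • (EuclideanSpace.single i 1 : E n)) 0 := by fun_prop
  have := hc.tendsto
  simp only [zero_smul, add_zero] at this
  have h := this.eventually hmax
  simpa [IsLocalMax, IsMaxFilter] using h

/-- Weak maximum principle: u + ε|X|² has Laplacian 2nε > 0 inside the ball, so its maximum lies on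
the boundary sphere; ε is taken small enough that εR² ≤ δ. -/
theorem le_of_hasLineLaplacianAt_zero {n : ℕ} (hn : 0 < n) {u : E n → ℝ} {R M : ℝ}
    (hc : ContinuousOn u (Metric.closedBall 0 R))
    (hu : ∀ X, ‖X‖ < R → HasLineLaplacianAt u 0 X) (hM : ∀ X, ‖X‖ = R → u X ≤ M) {X : E n}
    (hX : ‖X‖ ≤ R) : u X ≤ M := by
  have hn' : (0 : ℝ) < n := by exact_mod_cast hn
  refine le_of_forall_pos_le_add fun δ hδ => ?_
  set ε := δ / (R ^ 2 + 1) with hε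
  have hε0 : 0 < ε := by positivity
  have hεR : ε * R ^ 2 ≤ δ := by
    rw [hε, div_mul_eq_mul_div, div_le_iff₀ (by positivity)]
    nlinarith [sq_nonneg R]
  have hcw : ContinuousOn (fun X => u X + ε * ‖X‖ ^ 2) (Metric.closedBall 0 R) :=
    hc.add (by fun_prop)
  obtain ⟨Z, hZ, hZmax⟩ := (isCompact_closedBall (0 : E n) R).exists_isMaxOn
    ⟨X, mem_closedBall_zero_iff.2 hX⟩ hcw
  have hZX : u X + ε * ‖X‖ ^ 2 ≤ u Z + ε * ‖Z‖ ^ 2 := hZmax (mem_closedBall_zero_iff.2 hX)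
  have hZR : ‖Z‖ = R := by
    refine le_antisymm (mem_closedBall_zero_iff.1 hZ) (not_lt.1 fun hlt => ?_)
    have hloc : IsLocalMax (fun X => u X + ε * ‖X‖ ^ 2) Z :=
      hZmax.isLocalMax (Metric.closedBall_mem_nhds_of_mem (by simpa using hlt))
    have h := IsLocalMax.lineLaplacian_nonpos hloc
      ((hu Z hlt).add ((hasLineLaplacianAt_norm_sq Z).const_mul ε))
    have : 0 < ε * (2 * n) := by positivity
    linarith
  have h1 := hM Z hZR
  rw [hZR] at hZX
  have : 0 ≤ ε * ‖X‖ ^ 2 := by positivity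
  linarith

theorem ge_of_hasLineLaplacianAt_zero {n : ℕ} (hn : 0 < n) {u : E n → ℝ} {R M : ℝ}
    (hc : ContinuousOn u (Metric.closedBall 0 R))
    (hu : ∀ X, ‖X‖ < R → HasLineLaplacianAt u 0 X) (hM : ∀ X, ‖X‖ = R → M ≤ u X) {X : E n}
    (hX : ‖X‖ ≤ R) : M ≤ u X := by
  have h := le_of_hasLineLaplacianAt_zero (u := fun X => -1 * u X) (M := -M) hn
    (continuousOn_const.mul hc) (fun Z hZ => by simpa only [mul_zero] using (hu Z hZ).const_mul (-1))
    (fun Z hZ => by linarith [hM Z hZ]) hX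
  linarith

/-! ### The Poisson formula in the unit ball -/

theorem hasDerivAt_integral_surf {n : ℕ} {δ : ℝ} {K K' : ℝ → Sph n → ℝ}
    (hK : ContinuousOn (Function.uncurry K) (Icc (-δ) δ ×ˢ univ))
    (hK' : ContinuousOn (Function.uncurry K') (Icc (-δ) δ ×ˢ univ))
    (hd : ∀ t ∈ Icc (-δ) δ, ∀ y, HasDerivAt (fun t => K t y) (K' t y) t) {h : Sph n → ℝ}
    (hh : Continuous h) {t : ℝ} (ht : t ∈ Ioo (-δ) δ) :
    HasDerivAt (fun t => ∫ y, K t y * h y ∂(surf n)) (∫ y, K' t y * h y ∂(surf n)) t := by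
  have hcont : ∀ {F : ℝ → Sph n → ℝ}, ContinuousOn (Function.uncurry F) (Icc (-δ) δ ×ˢ univ) →
      ∀ t ∈ Icc (-δ) δ, Continuous fun y => F t y * h y := by
    intro F hF t ht
    refine Continuous.mul ?_ hh
    exact hF.comp_continuous (f := fun y : Sph n => (t, y)) (by fun_prop) fun y => ⟨ht, mem_univ _⟩
  obtain ⟨C, hC⟩ := (isCompact_Icc.prod isCompact_univ).exists_bound_of_continuousOn
    (hK'.mul (hh.comp continuous_snd).continuousOn)
  have hnhds : Icc (-δ) δ ∈ nhds t := Icc_mem_nhds ht.1 ht.2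
  refine (hasDerivAt_integral_of_dominated_loc_of_deriv_le (μ := surf n)
    (F := fun t y => K t y * h y) (F' := fun t y => K' t y * h y) (bound := fun _ => C)
    hnhds ?_ ?_ ?_ ?_ (integrable_const C) ?_).2
  · filter_upwards [hnhds] with r hr using (hcont hK r hr).aestronglyMeasurable
  · exact integrable_surf_of_continuous (hcont hK t (Ioo_subset_Icc_self ht))
  · exact (hcont hK' t (Ioo_subset_Icc_self ht)).aestronglyMeasurable
  · exact Filter.Eventually.of_forall fun y r hr => hC (r, y) ⟨hr, mem_univ _⟩
  · exact Filter.Eventually.of_forall fun y r hr => (hd r hr y).mul_const _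

/-- The function `N D^{-m}` for `N = a - 2bt - t²`, `D = d + 2ct + t²`. -/
noncomputable def linePoisson (m a b c d t : ℝ) : ℝ :=
  (a - 2 * b * t - t ^ 2) * (d + 2 * c * t + t ^ 2) ^ (-m)

/-- The derivative of `linePoisson`. -/
noncomputable def linePoissonDeriv (m a b c d t : ℝ) : ℝ :=
  (-2 * b - 2 * t) * (d + 2 * c * t + t ^ 2) ^ (-m) -
    m * (a - 2 * b * t - t ^ 2) * (2 * c + 2 * t) * (d + 2 * c * t + t ^ 2) ^ (-m - 1)

/-- The second derivative of `linePoisson`. -/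
noncomputable def linePoissonDeriv2 (m a b c d t : ℝ) : ℝ :=
  -2 * (d + 2 * c * t + t ^ 2) ^ (-m) -
    2 * m * (-2 * b - 2 * t) * (2 * c + 2 * t) * (d + 2 * c * t + t ^ 2) ^ (-m - 1) -
    2 * m * (a - 2 * b * t - t ^ 2) * (d + 2 * c * t + t ^ 2) ^ (-m - 1) +
    m * (m + 1) * (a - 2 * b * t - t ^ 2) * (2 * c + 2 * t) ^ 2 *
      (d + 2 * c * t + t ^ 2) ^ (-m - 2)

theorem hasDerivAt_numer (a b t : ℝ) :
    HasDerivAt (fun t : ℝ => a - 2 * b * t - t ^ 2) (-2 * b - 2 * t) t := by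
  have h := (((hasDerivAt_id t).const_mul (2 * b)).const_sub a).sub ((hasDerivAt_id t).pow 2)
  exact h.congr_deriv (by simp)

theorem hasDerivAt_denom (c d t : ℝ) :
    HasDerivAt (fun t : ℝ => d + 2 * c * t + t ^ 2) (2 * c + 2 * t) t := by
  have h := (((hasDerivAt_id t).const_mul (2 * c)).const_add d).add ((hasDerivAt_id t).pow 2)
  exact h.congr_deriv (by simp)

theorem hasDerivAt_linePoisson (m a b : ℝ) {c d t : ℝ} (h : 0 < d + 2 * c * t + t ^ 2) :
    HasDerivAt (linePoisson m a b c d) (linePoissonDeriv m a b c d t) t := by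
  have hD := (hasDerivAt_denom c d t).rpow_const (p := -m) (Or.inl h.ne')
  refine ((hasDerivAt_numer a b t).mul hD).congr_deriv ?_
  simp only [linePoissonDeriv]
  ring

theorem hasDerivAt_linePoissonDeriv (m a b : ℝ) {c d t : ℝ} (h : 0 < d + 2 * c * t + t ^ 2) :
    HasDerivAt (linePoissonDeriv m a b c d) (linePoissonDeriv2 m a b c d t) t := by
  have hD := (hasDerivAt_denom c d t).rpow_const (p := -m) (Or.inl h.ne')
  have hD1 := (hasDerivAt_denom c d t).rpow_const (p := -m - 1) (Or.inl h.ne')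
  have hN' : HasDerivAt (fun t : ℝ => -2 * b - 2 * t) (-2) t := by
    simpa using ((hasDerivAt_id t).const_mul 2).const_sub (-2 * b)
  have hD' : HasDerivAt (fun t : ℝ => 2 * c + 2 * t) 2 t := by
    simpa using ((hasDerivAt_id t).const_mul 2).const_add (2 * c)
  have h3 := (hN'.mul hD).sub ((((hasDerivAt_numer a b t).const_mul m).mul hD').mul hD1)
  refine h3.congr_deriv ?_
  simp only [linePoissonDeriv2, Pi.mul_apply]
  have : -m - 1 - 1 = -m - 2 := by ring
  rw [this]
  ring

/-- The Poisson kernel of the ball, without the normalizing constant. -/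
noncomputable def ballPoisson {n : ℕ} (X y : E n) : ℝ :=
  (1 - ‖X‖ ^ 2) * (‖X - y‖ ^ 2) ^ (-((n : ℝ) / 2))

/-- Along a coordinate line both squared norms are quadratic in t, which reduces the derivatives of
the kernel to one-variable calculus. -/
theorem ballPoisson_add_smul_single {n : ℕ} (X y : E n) (i : Fin n) (t : ℝ) :
    ballPoisson (X + t • EuclideanSpace.single i 1) y =
      linePoisson ((n : ℝ) / 2) (1 - ‖X‖ ^ 2) (X i) ((X - y) i) (‖X - y‖ ^ 2) t := by
  have e : X + t • (EuclideanSpace.single i 1 : E n) - y =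
    (X - y) + t • (EuclideanSpace.single i 1 : E n) := by abel
  rw [ballPoisson, e, norm_add_smul_single_sq, norm_add_smul_single_sq, linePoisson]
  ring_nf

theorem norm_sub_pos_of_lt {n : ℕ} {X : E n} (hX : ‖X‖ < 1) (y : Sph n) : 0 < ‖X - y‖ := by
  refine norm_pos_iff.2 fun h => ?_
  rw [sub_eq_zero] at h
  rw [h, norm_eq_of_mem_sphere] at hX
  exact lt_irrefl _ hX

theorem denom_pos {n : ℕ} {X : E n} {t : ℝ} (i : Fin n) (ht : ‖X‖ + |t| < 1) (y : Sph n) :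
    0 < ‖X - y‖ ^ 2 + 2 * (X - (y : E n)) i * t + t ^ 2 := by
  have e : ‖X - y‖ ^ 2 + 2 * (X - (y : E n)) i * t + t ^ 2 =
      ‖X + t • (EuclideanSpace.single i 1 : E n) - y‖ ^ 2 := by
    have e : X + t • (EuclideanSpace.single i 1 : E n) - y =
      (X - y) + t • (EuclideanSpace.single i 1 : E n) := by abel
    rw [e, norm_add_smul_single_sq]
    ring
  rw [e]
  refine pow_pos (norm_sub_pos_of_lt ?_ y) 2
  refine (norm_add_le _ _).trans_lt ?_
  rw [norm_smul, PiLp.norm_single]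
  simpa using ht

/-- The Poisson kernel is harmonic. -/
theorem sum_linePoissonDeriv2 {n : ℕ} {X : E n} (hX : ‖X‖ < 1) (y : Sph n) :
    ∑ i, linePoissonDeriv2 ((n : ℝ) / 2) (1 - ‖X‖ ^ 2) (X i) ((X - (y : E n)) i)
      (‖X - y‖ ^ 2) 0 = 0 := by
  have hpos := norm_sub_pos_of_lt hX y
  have hd : 0 < ‖X - y‖ ^ 2 := by positivity
  set d := ‖X - y‖ ^ 2 with hd_def
  set m : ℝ := (n : ℝ) / 2 with hm
  have r1 : d ^ (-m) = d ^ (-m - 1) * d := by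
    rw [← Real.rpow_add_one hd.ne']; ring_nf
  have r2 : d ^ (-m - 2) = d ^ (-m - 1) / d := by
    rw [← Real.rpow_sub_one hd.ne']; ring_nf
  have s1 : ∑ i, ((X - (y : E n)) i) ^ 2 = d := by
    rw [hd_def, EuclideanSpace.norm_sq_eq]; simp
  have s2 : ∑ i, X i * (X - (y : E n)) i = inner ℝ X (X - (y : E n)) := by
    rw [PiLp.inner_apply]; simp [mul_comm]
  have e : ∀ i, linePoissonDeriv2 m (1 - ‖X‖ ^ 2) (X i) ((X - (y : E n)) i) d 0 =
      (-2 * d ^ (-m) - 2 * m * (1 - ‖X‖ ^ 2) * d ^ (-m - 1)) +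
      8 * m * d ^ (-m - 1) * (X i * (X - (y : E n)) i) +
      4 * m * (m + 1) * (1 - ‖X‖ ^ 2) * d ^ (-m - 2) * ((X - (y : E n)) i) ^ 2 := by
    intro i
    simp only [linePoissonDeriv2, mul_zero, add_zero, sub_zero, zero_pow two_ne_zero]
    ring
  simp_rw [e]
  rw [Finset.sum_add_distrib, Finset.sum_add_distrib, ← Finset.mul_sum, ← Finset.mul_sum, s1, s2,
    Finset.sum_const, Finset.card_univ, Fintype.card_fin, nsmul_eq_mul, r1, r2]
  have hn : (n : ℝ) = 2 * m := by rw [hm]; ring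
  have hdd : d = ‖X‖ ^ 2 - 2 * inner ℝ X (y : E n) + 1 := by
    rw [hd_def, norm_sub_sq_real, norm_eq_of_mem_sphere]; ring
  have hin : inner ℝ X (X - (y : E n)) = ‖X‖ ^ 2 - inner ℝ X (y : E n) := by
    rw [inner_sub_right, real_inner_self_eq_norm_sq]
  rw [hn, hin]
  -- Because |y| = 1, only |X|², d and m remain after this substitution; the sum then cancels
  -- because n = 2m.
  have hi : inner ℝ X (y : E n) = (‖X‖ ^ 2 + 1 - d) / 2 := by rw [hdd]; ring
  rw [hi]
  field_simp
  ring

theorem hasLineLaplacianAt_poissonIntegral {n : ℕ} {h : Sph n → ℝ} (hh : Continuous h) {X : E n}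
    (hX : ‖X‖ < 1) :
    HasLineLaplacianAt (fun X => ∫ y : Sph n, ballPoisson X y * h y ∂(surf n)) 0 X := by
  -- Half the distance to the boundary: the segments X + t e_i, |t| ≤ δ, stay in the open ball,
  -- where the kernel is smooth uniformly in y.
  set δ := (1 - ‖X‖) / 2 with hδ
  have hδ0 : 0 < δ := by rw [hδ]; linarith
  have hlt : ∀ t ∈ Icc (-δ) δ, ‖X‖ + |t| < 1 := fun t ht => by
    have := abs_le.2 ht
    linarith
  set m : ℝ := (n : ℝ) / 2
  have hrp : ∀ (i : Fin n) (p : ℝ), ContinuousOn (fun q : ℝ × Sph n =>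
      (‖X - q.2‖ ^ 2 + 2 * (X - (q.2 : E n)) i * q.1 + q.1 ^ 2) ^ p) (Icc (-δ) δ ×ˢ univ) := by
    intro i p
    refine ContinuousOn.rpow_const (Continuous.continuousOn ?_) fun q hq =>
      Or.inl (denom_pos i (hlt _ hq.1) q.2).ne'
    simp only [PiLp.sub_apply]
    fun_prop
  have hc : ∀ i : Fin n, ContinuousOn (fun q : ℝ × Sph n => (X - (q.2 : E n)) i)
      (Icc (-δ) δ ×ˢ univ) := fun i => by
    simp only [PiLp.sub_apply]
    fun_prop
  have c0 : ∀ i : Fin n, ContinuousOn (Function.uncurry fun (t : ℝ) (y : Sph n) =>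
      linePoisson m (1 - ‖X‖ ^ 2) (X i) ((X - (y : E n)) i) (‖X - y‖ ^ 2) t)
      (Icc (-δ) δ ×ˢ univ) := by
    intro i
    have h1 := hrp i (-m)
    simp only [Function.uncurry_def, linePoisson]
    fun_prop
  have c1 : ∀ i : Fin n, ContinuousOn (Function.uncurry fun (t : ℝ) (y : Sph n) =>
      linePoissonDeriv m (1 - ‖X‖ ^ 2) (X i) ((X - (y : E n)) i) (‖X - y‖ ^ 2) t)
      (Icc (-δ) δ ×ˢ univ) := by
    intro i
    have h1 := hrp i (-m)
    have h2 := hrp i (-m - 1)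
    have h3 := hc i
    simp only [Function.uncurry_def, linePoissonDeriv]
    fun_prop
  have c2 : ∀ i : Fin n, ContinuousOn (Function.uncurry fun (t : ℝ) (y : Sph n) =>
      linePoissonDeriv2 m (1 - ‖X‖ ^ 2) (X i) ((X - (y : E n)) i) (‖X - y‖ ^ 2) t)
      (Icc (-δ) δ ×ˢ univ) := by
    intro i
    have h1 := hrp i (-m)
    have h2 := hrp i (-m - 1)
    have h4 := hrp i (-m - 2)
    have h3 := hc i
    simp only [Function.uncurry_def, linePoissonDeriv2]
    fun_prop
  have h0 : (0 : ℝ) ∈ Ioo (-δ) δ := ⟨by linarith, hδ0⟩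
  refine ⟨fun i t => ∫ y : Sph n, linePoissonDeriv m (1 - ‖X‖ ^ 2) (X i) ((X - (y : E n)) i)
    (‖X - y‖ ^ 2) t * h y ∂(surf n), fun i => ∫ y : Sph n, linePoissonDeriv2 m (1 - ‖X‖ ^ 2) (X i)
    ((X - (y : E n)) i) (‖X - y‖ ^ 2) 0 * h y ∂(surf n), fun i => ?_, fun i => ?_, ?_⟩
  · filter_upwards [Ioo_mem_nhds h0.1 h0.2] with t ht
    simp_rw [ballPoisson_add_smul_single]
    exact hasDerivAt_integral_surf (c0 i) (c1 i)
      (fun t ht y => hasDerivAt_linePoisson _ _ _ (denom_pos i (hlt t ht) y)) hh ht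
  · exact hasDerivAt_integral_surf (c1 i) (c2 i)
      (fun t ht y => hasDerivAt_linePoissonDeriv _ _ _ (denom_pos i (hlt t ht) y)) hh h0
  · rw [← integral_finsetSum]
    · simp_rw [← Finset.sum_mul, m, sum_linePoissonDeriv2 hX]
      simp
    · intro i _
      refine integrable_surf_of_continuous (Continuous.mul ?_ hh)
      exact (c2 i).comp_continuous (f := fun y : Sph n => ((0 : ℝ), y)) (by fun_prop)
        fun y => ⟨Ioo_subset_Icc_self h0, mem_univ _⟩

theorem continuousOn_ballPoisson {n : ℕ} {R : ℝ} (hR : R < 1) :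
    ContinuousOn (fun q : E n × Sph n => ballPoisson q.1 (q.2 : E n))
      (Metric.closedBall 0 R ×ˢ univ) := by
  unfold ballPoisson
  refine ContinuousOn.mul (by fun_prop) (ContinuousOn.rpow_const (by fun_prop) fun q hq => Or.inl ?_)
  have := norm_sub_pos_of_lt ((mem_closedBall_zero_iff.1 hq.1).trans_lt hR) q.2
  positivity

theorem continuous_ballPoisson {n : ℕ} {X : E n} (hX : ‖X‖ < 1) :
    Continuous fun y : Sph n => ballPoisson X (y : E n) :=
  (continuousOn_ballPoisson hX).comp_continuous (f := fun y : Sph n => (X, y)) (by fun_prop)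
    fun y => ⟨mem_closedBall_zero_iff.2 le_rfl, mem_univ _⟩

theorem continuousOn_poissonIntegral {n : ℕ} {h : Sph n → ℝ} (hh : Continuous h) {R : ℝ}
    (hR : R < 1) :
    ContinuousOn (fun X : E n => ∫ y : Sph n, ballPoisson X y * h y ∂(surf n))
      (Metric.closedBall 0 R) := by
  rw [continuousOn_iff_continuous_domRestrict]
  have hcont : Continuous (Function.uncurry fun (X : Metric.closedBall (0 : E n) R) (y : Sph n) =>
      ballPoisson (X : E n) y * h y) := by
    refine Continuous.mul ?_ (hh.comp continuous_snd)
    exact (continuousOn_ballPoisson hR).comp_continuous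
      (f := fun q : Metric.closedBall (0 : E n) R × Sph n => ((q.1 : E n), q.2)) (by fun_prop)
      fun q => ⟨q.1.2, mem_univ _⟩
  have := continuous_parametric_integral_of_continuous (μ := surf n) hcont isCompact_univ
  rw [Measure.restrict_univ] at this
  exact this

theorem ballPoisson_nonneg {n : ℕ} {X : E n} (hX : ‖X‖ ≤ 1) (y : E n) : 0 ≤ ballPoisson X y := by
  have : 0 ≤ 1 - ‖X‖ ^ 2 := by nlinarith [norm_nonneg X]
  unfold ballPoisson
  positivity

/-- As a function of X the integral is harmonic and invariant under isometries, hence constant on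
the sphere of radius |X|. The maximum principle in both directions equates its value with that at
the origin, where the kernel is 1 on the unit sphere. -/
theorem integral_ballPoisson {n : ℕ} (hn : 3 ≤ n) {X : E n} (hX : ‖X‖ < 1) :
    ∫ y : Sph n, ballPoisson X y ∂(surf n) = sphereArea n := by
  set F : E n → ℝ := fun X => ∫ y : Sph n, ballPoisson X y * 1 ∂(surf n) with hF
  have hinv : ∀ Z : E n, ‖Z‖ = ‖X‖ → F Z = F X := by
    intro Z hZ
    -- The reflection in the hyperplane orthogonal to X - Z carries X to Z when their norms agree.
    set e := (Submodule.span ℝ {X - Z})ᗮ.reflection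
    have he : e X = Z := Submodule.reflection_sub hZ.symm
    have hc := continuous_ballPoisson (hZ.trans_lt hX)
    simp only [hF, mul_one]
    rw [← integral_sphereMap e hc]
    refine integral_congr_ae (Filter.Eventually.of_forall fun y => ?_)
    simp only [ballPoisson, sphereMap]
    rw [← he, ← map_sub, e.norm_map, e.norm_map]
  have hcont := continuousOn_poissonIntegral (h := fun _ : Sph n => (1 : ℝ)) continuous_const hX
  have hh : ∀ Z : E n, ‖Z‖ < ‖X‖ → HasLineLaplacianAt F 0 Z := fun Z hZ =>
    hasLineLaplacianAt_poissonIntegral continuous_const (hZ.trans hX)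
  have h1 : F 0 ≤ F X := le_of_hasLineLaplacianAt_zero (by omega) hcont hh
    (fun Z hZ => (hinv Z hZ).le) (by simp)
  have h2 : F X ≤ F 0 := ge_of_hasLineLaplacianAt_zero (by omega) hcont hh
    (fun Z hZ => (hinv Z hZ).ge) (by simp)
  have h0 : F 0 = sphereArea n := by
    simp only [hF, mul_one, ballPoisson, zero_sub, norm_neg, norm_eq_of_mem_sphere]
    simp [surf_real_univ hn]
  have : F X = sphereArea n := by linarith
  simpa [hF] using this

/-- Near the boundary, the Poisson integral of `p` is close to `p`. -/
theorem exists_abs_poissonIntegral_sub_le {n : ℕ} (hn : 3 ≤ n) {p : E n → ℝ} (hp : Continuous p)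
    {ε : ℝ} (hε : 0 < ε) : ∃ R < 1, ∀ X : E n, R ≤ ‖X‖ → ‖X‖ < 1 →
      |∫ y : Sph n, ballPoisson X y * p y ∂(surf n) - sphereArea n * p X| ≤ ε := by
  have hω := sphereArea_pos hn
  have hcomp : IsCompact (Metric.closedBall (0 : E n) 1) := isCompact_closedBall _ _
  obtain ⟨M, hM⟩ := hcomp.exists_bound_of_continuousOn hp.continuousOn
  have hM0 : 0 ≤ M := (norm_nonneg _).trans (hM 0 (by simp))
  obtain ⟨δ, hδ, hδ'⟩ := Metric.uniformContinuousOn_iff.1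
    (hcomp.uniformContinuousOn_of_continuous hp.continuousOn) (ε / (2 * sphereArea n))
    (by positivity)
  set A : ℝ := (δ ^ 2) ^ (-((n : ℝ) / 2)) with hA
  have hA0 : 0 < A := by positivity
  -- Where |X - y| ≥ δ the kernel is at most 2ηA and the oscillation of p at most 2M; this η makes
  -- that contribution at most ε/2. The other ε/2 comes from uniform continuity and the mass of the
  -- kernel.
  set η : ℝ := ε / (8 * (M + 1) * A * sphereArea n) with hη
  have hη0 : 0 < η := by positivity
  refine ⟨1 - min η 1, by have := lt_min hη0 one_pos; linarith, fun X hXR hX => ?_⟩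
  have hX1 : 1 - ‖X‖ ≤ η := by linarith [min_le_left η 1]
  have hnn := ballPoisson_nonneg hX.le
  have hcP := continuous_ballPoisson hX
  have e : ∫ y : Sph n, ballPoisson X y * p y ∂(surf n) - sphereArea n * p X =
      ∫ y : Sph n, ballPoisson X y * (p y - p X) ∂(surf n) := by
    rw [← integral_ballPoisson hn hX, ← integral_mul_const, ← integral_sub]
    · simp_rw [mul_sub]
    · exact integrable_surf_of_continuous (hcP.mul (hp.comp continuous_subtype_val))
    · exact integrable_surf_of_continuous (hcP.mul continuous_const)
  rw [e]
  have hpt : ∀ y : Sph n, ‖ballPoisson X (y : E n) * (p y - p X)‖ ≤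
      ballPoisson X (y : E n) * (ε / (2 * sphereArea n)) + 2 * η * A * (2 * M) := by
    intro y
    have hy1 : (y : E n) ∈ Metric.closedBall (0 : E n) 1 := by simp
    have hX1' : X ∈ Metric.closedBall (0 : E n) 1 := by simpa using hX.le
    rw [norm_mul, Real.norm_of_nonneg (hnn y)]
    rcases lt_or_ge (dist (y : E n) X) δ with hd | hd
    · have h1 := (hδ' _ hy1 _ hX1' hd).le
      rw [Real.dist_eq] at h1
      have h2 := mul_le_mul_of_nonneg_left h1 (hnn y)
      have h3 : 0 ≤ 2 * η * A * (2 * M) := by positivity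
      rw [Real.norm_eq_abs]
      linarith
    · have h1 : ‖p y - p X‖ ≤ 2 * M := by
        refine (norm_sub_le _ _).trans ?_
        linarith [hM _ hy1, hM _ hX1']
      have h2 : ballPoisson X (y : E n) ≤ 2 * η * A := by
        unfold ballPoisson
        have h3 : (‖X - y‖ ^ 2) ^ (-((n : ℝ) / 2)) ≤ A := by
          refine Real.rpow_le_rpow_of_nonpos (by positivity) ?_
            (by have : (0 : ℝ) ≤ n := Nat.cast_nonneg n; linarith)
          rw [dist_comm, dist_eq_norm] at hd
          gcongr
        have h4 : 1 - ‖X‖ ^ 2 ≤ 2 * η := by nlinarith [norm_nonneg X]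
        gcongr
      have h5 := mul_le_mul h2 h1 (norm_nonneg _) (by positivity)
      have h6 : 0 ≤ ballPoisson X (y : E n) * (ε / (2 * sphereArea n)) :=
        mul_nonneg (hnn y) (by positivity)
      linarith
  have hint : Integrable (fun y : Sph n => ballPoisson X (y : E n) * (ε / (2 * sphereArea n)))
      (surf n) := integrable_surf_of_continuous (hcP.mul continuous_const)
  have h1 := norm_integral_le_of_norm_le (hint.add (integrable_const _))
    (Filter.Eventually.of_forall hpt)
  rw [Real.norm_eq_abs] at h1
  refine h1.trans ?_
  simp only [Pi.add_apply]
  rw [integral_add hint (integrable_const _), integral_mul_const, integral_ballPoisson hn hX,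
    integral_const, surf_real_univ hn, smul_eq_mul]
  have h2 : sphereArea n * (2 * η * A * (2 * M)) ≤ ε / 2 := by
    have : sphereArea n * (2 * η * A * (2 * M)) = ε / 2 * (M / (M + 1)) := by
      rw [hη]; field_simp; ring
    rw [this]
    have : M / (M + 1) ≤ 1 := (div_le_one (by linarith)).2 (by linarith)
    nlinarith
  have h3 : sphereArea n * (ε / (2 * sphereArea n)) = ε / 2 := by field_simp
  linarith

/-- The Poisson formula. -/
theorem integral_ballPoisson_mul_of_harmonic {n : ℕ} (hn : 3 ≤ n) {p : E n → ℝ}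
    (hp : Continuous p) (hh : ∀ X, ‖X‖ < 1 → HasLineLaplacianAt p 0 X) {X : E n} (hX : ‖X‖ < 1) :
    ∫ y : Sph n, ballPoisson X y * p y ∂(surf n) = sphereArea n * p X := by
  rw [← sub_eq_zero, ← abs_nonpos_iff]
  refine le_of_forall_pos_le_add fun ε hε => ?_
  rw [zero_add]
  obtain ⟨R, hR, hR'⟩ := exists_abs_poissonIntegral_sub_le hn hp hε
  -- The maximum principle is applied on a ball of radius ρ < 1 containing X, so the Poisson
  -- integral never has to be extended continuously to the unit sphere.
  obtain ⟨ρ, hρ, hρ1⟩ := exists_between (max_lt hR hX)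
  have hρR : R ≤ ρ := (le_max_left _ _).trans hρ.le
  have hρX : ‖X‖ ≤ ρ := (le_max_right _ _).trans hρ.le
  have hcp : Continuous fun y : Sph n => p y := hp.comp continuous_subtype_val
  have hlap : ∀ Z : E n, ‖Z‖ < ρ → HasLineLaplacianAt (fun X =>
      ∫ y : Sph n, ballPoisson X y * p y ∂(surf n) + -sphereArea n * p X) 0 Z := fun Z hZ => by
    simpa using (hasLineLaplacianAt_poissonIntegral hcp (hZ.trans hρ1)).add
      ((hh Z (hZ.trans hρ1)).const_mul (-sphereArea n))
  have hcont : ContinuousOn (fun X =>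
      ∫ y : Sph n, ballPoisson X y * p y ∂(surf n) + -sphereArea n * p X)
      (Metric.closedBall 0 ρ) :=
    (continuousOn_poissonIntegral hcp hρ1).add (by fun_prop)
  have hb : ∀ Z : E n, ‖Z‖ = ρ →
      |∫ y : Sph n, ballPoisson Z y * p y ∂(surf n) - sphereArea n * p Z| ≤ ε := fun Z hZ =>
    hR' Z (hZ ▸ hρR) (hZ ▸ hρ1)
  have h1 := le_of_hasLineLaplacianAt_zero (M := ε) (by omega) hcont hlap
    (fun Z hZ => by linarith [(abs_le.1 (hb Z hZ)).2]) hρX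
  have h2 := ge_of_hasLineLaplacianAt_zero (M := -ε) (by omega) hcont hlap
    (fun Z hZ => by linarith [(abs_le.1 (hb Z hZ)).1]) hρX
  exact abs_le.2 ⟨by linarith, by linarith⟩

theorem poissonKer_dot {n : ℕ} {r : ℝ} (x y : Sph n) :
    poissonKer n r (dot x y) = ballPoisson (r • (x : E n)) y / sphereArea n := by
  have e1 : ‖r • (x : E n)‖ ^ 2 = r ^ 2 := by
    rw [norm_smul, norm_eq_of_mem_sphere, mul_one, Real.norm_eq_abs, sq_abs]
  have e2 : ‖r • (x : E n) - y‖ ^ 2 = 1 - 2 * r * dot x y + r ^ 2 := by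
    rw [norm_sub_sq_real, e1, norm_eq_of_mem_sphere, inner_smul_left, dot]
    simp
    ring
  rw [poissonKer, ballPoisson, e1, e2, Real.rpow_neg (by rw [← e2]; positivity)]
  ring

theorem norm_smul_sphere {n : ℕ} {r : ℝ} (hr0 : 0 ≤ r) (x : Sph n) : ‖r • (x : E n)‖ = r := by
  rw [norm_smul, norm_eq_of_mem_sphere, mul_one, Real.norm_of_nonneg hr0]

theorem integral_poissonKer_mul_of_harmonic {n : ℕ} (hn : 3 ≤ n) {p : E n → ℝ}
    (hp : Continuous p) (hh : ∀ X, ‖X‖ < 1 → HasLineLaplacianAt p 0 X) {r : ℝ} (hr0 : 0 ≤ r)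
    (hr1 : r < 1) (x : Sph n) :
    ∫ y : Sph n, poissonKer n r (dot x y) * p y ∂(surf n) = p (r • (x : E n)) := by
  have hω := sphereArea_pos hn
  have h := integral_ballPoisson_mul_of_harmonic hn hp hh (X := r • (x : E n))
    (by rwa [norm_smul_sphere hr0])
  simp_rw [poissonKer_dot, div_mul_eq_mul_div]
  rw [integral_div, h]
  field_simp

/-! ### Harmonic polynomials -/

/-- The polynomial `|X|²`. -/
noncomputable def normSqPoly (n : ℕ) : MvPolynomial (Fin n) ℝ := ∑ i, MvPolynomial.X i ^ 2

/-- The value of a polynomial at a point of `ℝⁿ`. -/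
noncomputable def polyEval {n : ℕ} (p : MvPolynomial (Fin n) ℝ) (X : E n) : ℝ :=
  MvPolynomial.aeval (fun i => X i) p

theorem polyRestrict_apply {n : ℕ} (p : MvPolynomial (Fin n) ℝ) (x : Sph n) :
    polyRestrict n p x = polyEval p (x : E n) := rfl

theorem polyLaplacian_apply {n : ℕ} (p : MvPolynomial (Fin n) ℝ) :
    polyLaplacian n p = ∑ i, MvPolynomial.pderiv i (MvPolynomial.pderiv i p) := by
  simp [polyLaplacian, LinearMap.sum_apply]

theorem continuous_polyEval {n : ℕ} (p : MvPolynomial (Fin n) ℝ) : Continuous (polyEval p) := by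
  unfold polyEval
  induction p using MvPolynomial.induction_on with
  | C a => simpa using continuous_const
  | add p q hp hq => simp only [map_add]; exact hp.add hq
  | mul_X p i hp =>
    simp only [map_mul, MvPolynomial.aeval_X]
    exact hp.mul (by fun_prop)

theorem polyEval_smul_of_isHomogeneous {n k : ℕ} {p : MvPolynomial (Fin n) ℝ}
    (hp : p.IsHomogeneous k) (r : ℝ) (X : E n) : polyEval p (r • X) = r ^ k * polyEval p X := by
  simp only [polyEval, MvPolynomial.aeval_def, MvPolynomial.eval₂_eq, Finset.mul_sum]
  refine Finset.sum_congr rfl fun d hd => ?_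
  have h1 : ∑ i ∈ d.support, d i = k := by
    rw [← hp.degree_eq_sum_deg_support hd]
  simp only [PiLp.smul_apply, smul_eq_mul, mul_pow, Finset.prod_mul_distrib]
  rw [Finset.prod_pow_eq_pow_sum, h1]
  ring

theorem hasDerivAt_polyEval {n : ℕ} (p : MvPolynomial (Fin n) ℝ) (X : E n) (i : Fin n) (t : ℝ) :
    HasDerivAt (fun t : ℝ => polyEval p (X + t • EuclideanSpace.single i 1))
      (polyEval (MvPolynomial.pderiv i p) (X + t • EuclideanSpace.single i 1)) t := by
  unfold polyEval
  induction p using MvPolynomial.induction_on with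
  | C a => simpa using hasDerivAt_const t a
  | add p q hp hq => simp only [map_add]; exact hp.add hq
  | mul_X p j hp =>
    have hj : HasDerivAt (fun t : ℝ => (X + t • (EuclideanSpace.single i 1 : E n)) j)
        (if i = j then 1 else 0) t := by
      have := ((hasDerivAt_id t).mul_const ((EuclideanSpace.single i 1 : E n) j)).const_add (X j)
      refine (this.congr_deriv ?_)
      by_cases h : i = j
      · simp [h]
      · simp [h, Ne.symm h]
    simp only [map_mul, MvPolynomial.aeval_X]
    refine (hp.mul hj).congr_deriv ?_
    by_cases h : i = j
    · subst h
      simp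
      ring
    · have h' : ¬j = i := Ne.symm h
      simp [h, h', MvPolynomial.pderiv_X_of_ne h']
      ring

theorem hasLineLaplacianAt_polyEval {n : ℕ} (p : MvPolynomial (Fin n) ℝ) (X : E n) :
    HasLineLaplacianAt (polyEval p) (polyEval (polyLaplacian n p) X) X := by
  refine ⟨fun i t => polyEval (MvPolynomial.pderiv i p) (X + t • EuclideanSpace.single i 1),
    fun i => polyEval (MvPolynomial.pderiv i (MvPolynomial.pderiv i p)) X,
    fun i => Filter.Eventually.of_forall fun t => hasDerivAt_polyEval p X i t, fun i => ?_, ?_⟩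
  · simpa using hasDerivAt_polyEval (MvPolynomial.pderiv i p) X i 0
  · rw [polyLaplacian_apply]
    simp [polyEval]

theorem pderiv_normSqPoly {n : ℕ} (i : Fin n) :
    MvPolynomial.pderiv i (normSqPoly n) = 2 * MvPolynomial.X i := by
  rw [normSqPoly, map_sum, Finset.sum_eq_single i]
  · rw [MvPolynomial.pderiv_pow, MvPolynomial.pderiv_X_self]; simp
  · intro j _ hj
    rw [MvPolynomial.pderiv_pow, MvPolynomial.pderiv_X_of_ne hj]; simp
  · simp

theorem isHomogeneous_normSqPoly (n : ℕ) : (normSqPoly n).IsHomogeneous 2 :=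
  MvPolynomial.IsHomogeneous.sum _ _ _ fun i _ => MvPolynomial.isHomogeneous_X_pow i 2

/-- Leibniz rule; Euler's identity turns the cross term 4 X·∇f into 4d f. -/
theorem polyLaplacian_normSqPoly_mul {n d : ℕ} {f : MvPolynomial (Fin n) ℝ}
    (hf : f.IsHomogeneous d) :
    polyLaplacian n (normSqPoly n * f) =
      (2 * n + 4 * d : ℕ) • f + normSqPoly n * polyLaplacian n f := by
  simp only [polyLaplacian_apply]
  have e : ∀ i : Fin n, MvPolynomial.pderiv i (MvPolynomial.pderiv i (normSqPoly n * f)) =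
      2 * f + 4 * (MvPolynomial.X i * MvPolynomial.pderiv i f) +
        normSqPoly n * MvPolynomial.pderiv i (MvPolynomial.pderiv i f) := by
    intro i
    have h2 : MvPolynomial.pderiv i (2 : MvPolynomial (Fin n) ℝ) = 0 := by
      have : (2 : MvPolynomial (Fin n) ℝ) = MvPolynomial.C 2 := (map_ofNat MvPolynomial.C 2).symm
      rw [this, MvPolynomial.pderiv_C]
    simp only [MvPolynomial.pderiv_mul, pderiv_normSqPoly, map_add, h2,
      MvPolynomial.pderiv_X_self]
    ring
  simp_rw [e]
  rw [Finset.sum_add_distrib, Finset.sum_add_distrib, ← Finset.mul_sum, ← Finset.mul_sum,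
    ← Finset.mul_sum, hf.sum_X_mul_pderiv]
  simp only [Finset.sum_const, Finset.card_univ, Fintype.card_fin, nsmul_eq_mul]
  push_cast
  ring

theorem exists_polyLaplacian_normSqPoly_pow_mul {n : ℕ} (hn : 0 < n) {i : ℕ}
    {h : MvPolynomial (Fin n) ℝ} (hi : h.IsHomogeneous i) (hh : polyLaplacian n h = 0) (j : ℕ) :
    ∃ c : ℕ, 0 < c ∧
      polyLaplacian n (normSqPoly n ^ (j + 1) * h) = c • (normSqPoly n ^ j * h) := by
  induction j with
  | zero =>
    refine ⟨2 * n + 4 * i, by omega, ?_⟩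
    rw [zero_add, pow_one, polyLaplacian_normSqPoly_mul hi, hh, mul_zero, add_zero, pow_zero,
      one_mul]
  | succ j ih =>
    obtain ⟨c, hc, ih⟩ := ih
    have hd : (normSqPoly n ^ (j + 1) * h).IsHomogeneous (2 * (j + 1) + i) :=
      ((isHomogeneous_normSqPoly n).pow (j + 1)).mul hi
    refine ⟨2 * n + 4 * (2 * (j + 1) + i) + c, by omega, ?_⟩
    rw [pow_succ' _ (j + 1), mul_assoc, polyLaplacian_normSqPoly_mul hd, ih,
      mul_smul_comm, ← mul_assoc, ← pow_succ', ← add_smul]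

/-- The span of the polynomials `|X|^{2j} h` of degree `k`, `h` harmonic and homogeneous. -/
noncomputable def harmonicSpan (n k : ℕ) : Submodule ℝ (MvPolynomial (Fin n) ℝ) :=
  Submodule.span ℝ {q | ∃ (j i : ℕ) (h : MvPolynomial (Fin n) ℝ), h.IsHomogeneous i ∧
    polyLaplacian n h = 0 ∧ 2 * j + i = k ∧ q = normSqPoly n ^ j * h}

theorem isHomogeneous_of_mem_harmonicSpan {n k : ℕ} {q : MvPolynomial (Fin n) ℝ}
    (hq : q ∈ harmonicSpan n k) : q.IsHomogeneous k := by
  rw [← MvPolynomial.mem_homogeneousSubmodule]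
  refine Submodule.span_le.2 ?_ hq
  rintro _ ⟨j, i, h, hi, _, rfl, rfl⟩
  exact ((isHomogeneous_normSqPoly n).pow j).mul hi

/-- The Laplacian sends |X|^{2(j+1)} h to a positive multiple of |X|^{2j} h for h harmonic and
homogeneous, so each generator can be inverted explicitly. -/
theorem exists_polyLaplacian_eq_of_mem_harmonicSpan {n k : ℕ} (hn : 0 < n)
    {q : MvPolynomial (Fin n) ℝ} (hq : q ∈ harmonicSpan n k) :
    ∃ g ∈ harmonicSpan n (k + 2), polyLaplacian n g = q := by
  suffices h : harmonicSpan n k ≤ (harmonicSpan n (k + 2)).map (polyLaplacian n) from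
    Submodule.mem_map.1 (h hq)
  refine Submodule.span_le.2 ?_
  rintro _ ⟨j, i, h, hi, hh, rfl, rfl⟩
  obtain ⟨c, hc, hc'⟩ := exists_polyLaplacian_normSqPoly_pow_mul hn hi hh j
  have hc0 : (c : ℝ) ≠ 0 := by exact_mod_cast hc.ne'
  refine ⟨(c : ℝ)⁻¹ • (normSqPoly n ^ (j + 1) * h), Submodule.smul_mem _ _ (Submodule.subset_span
    ⟨j + 1, i, h, hi, hh, by ring, rfl⟩), ?_⟩
  rw [map_smul, hc', ← Nat.cast_smul_eq_nsmul ℝ, smul_smul, inv_mul_cancel₀ hc0, one_smul]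

theorem polyLaplacian_eq_zero_of_lt_two {n k : ℕ} (hk : k < 2) {p : MvPolynomial (Fin n) ℝ}
    (hp : p.IsHomogeneous k) : polyLaplacian n p = 0 := by
  rw [polyLaplacian_apply]
  refine Finset.sum_eq_zero fun i _ => ?_
  have h1 : (MvPolynomial.pderiv i p).IsHomogeneous 0 := by
    have := hp.pderiv (i := i)
    rwa [show k - 1 = 0 by omega] at this
  rw [← MvPolynomial.totalDegree_zero_iff_isHomogeneous,
    MvPolynomial.totalDegree_eq_zero_iff_eq_C] at h1
  rw [h1, MvPolynomial.pderiv_C]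

theorem isHomogeneous_polyLaplacian {n k : ℕ} {p : MvPolynomial (Fin n) ℝ}
    (hp : p.IsHomogeneous (k + 2)) : (polyLaplacian n p).IsHomogeneous k := by
  rw [polyLaplacian_apply]
  exact MvPolynomial.IsHomogeneous.sum _ _ _ fun i _ => (hp.pderiv (i := i)).pderiv (i := i)

/-- Every homogeneous polynomial is a combination of harmonic polynomials with coefficients that
are powers of `|X|²`. -/
theorem mem_harmonicSpan_of_isHomogeneous {n : ℕ} (hn : 0 < n) (k : ℕ) :
    ∀ p : MvPolynomial (Fin n) ℝ, p.IsHomogeneous k → p ∈ harmonicSpan n k := by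
  have base : ∀ {k : ℕ} {p : MvPolynomial (Fin n) ℝ}, p.IsHomogeneous k → polyLaplacian n p = 0 →
      p ∈ harmonicSpan n k := fun {k p} hp h =>
    Submodule.subset_span ⟨0, k, p, hp, h, by simp, by simp⟩
  induction k using Nat.strong_induction_on with
  | _ k ih =>
    intro p hp
    rcases lt_or_ge k 2 with hk | hk
    · exact base hp (polyLaplacian_eq_zero_of_lt_two hk hp)
    · obtain ⟨k, rfl⟩ := Nat.exists_eq_add_of_le' hk
      -- By induction Δp is in the span in degree k; a preimage g of it in the span in degree k+2
      -- makes p - g harmonic.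
      obtain ⟨g, hg, hg'⟩ := exists_polyLaplacian_eq_of_mem_harmonicSpan hn
        (ih k (by omega) _ (isHomogeneous_polyLaplacian hp))
      have h1 : p - g ∈ harmonicSpan n (k + 2) :=
        base (hp.sub (isHomogeneous_of_mem_harmonicSpan hg)) (by rw [map_sub, hg', sub_self])
      simpa using Submodule.add_mem _ h1 hg

theorem polyRestrict_mem_SH {n k : ℕ} {h : MvPolynomial (Fin n) ℝ} (hk : h.IsHomogeneous k)
    (hh : polyLaplacian n h = 0) : polyRestrict n h ∈ SH n k :=
  ⟨h, ⟨hk, hh⟩, rfl⟩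

theorem polyRestrict_normSqPoly_pow_mul {n : ℕ} (j : ℕ) (h : MvPolynomial (Fin n) ℝ) :
    polyRestrict n (normSqPoly n ^ j * h) = polyRestrict n h := by
  funext x
  have h1 : ∑ i, (x : E n) i ^ 2 = 1 := by
    have := EuclideanSpace.norm_sq_eq (x : E n)
    rw [norm_eq_of_mem_sphere] at this
    simpa using this.symm
  simp only [polyRestrict_apply, polyEval, map_mul, map_pow, normSqPoly, map_sum,
    MvPolynomial.aeval_X, h1, one_pow, one_mul]

/-- On the sphere, every polynomial is a sum of spherical harmonics. -/
theorem polyRestrict_mem_iSup_SH {n : ℕ} (hn : 0 < n) (p : MvPolynomial (Fin n) ℝ) :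
    polyRestrict n p ∈ ⨆ k, SH n k := by
  rw [← MvPolynomial.sum_homogeneousComponent p, map_sum]
  refine Submodule.sum_mem _ fun k _ => ?_
  have h1 := mem_harmonicSpan_of_isHomogeneous hn k _
    (MvPolynomial.homogeneousComponent_isHomogeneous k p)
  have h2 : harmonicSpan n k ≤ (⨆ k, SH n k).comap (polyRestrict n) := by
    refine Submodule.span_le.2 ?_
    rintro _ ⟨j, i, h, hi, hh, rfl, rfl⟩
    simp only [SetLike.mem_coe, Submodule.mem_comap, polyRestrict_normSqPoly_pow_mul]
    exact Submodule.mem_iSup_of_mem i (polyRestrict_mem_SH hi hh)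
  exact h2 h1

/-- Polynomials are dense in the continuous functions on the sphere. -/
theorem exists_polyRestrict_near {n : ℕ} {u : Sph n → ℝ} (hu : Continuous u) {ε : ℝ}
    (hε : 0 < ε) : ∃ p : MvPolynomial (Fin n) ℝ, ∀ x, |polyRestrict n p x - u x| < ε := by
  let coord : Fin n → C(Sph n, ℝ) := fun i => ⟨fun x => (x : E n) i, by fun_prop⟩
  let φ : MvPolynomial (Fin n) ℝ →ₐ[ℝ] C(Sph n, ℝ) := MvPolynomial.aeval coord
  have hφ : ∀ p x, φ p x = polyRestrict n p x := by
    intro p x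
    rw [polyRestrict_apply, polyEval]
    have h : (ContinuousMap.evalAlgHom ℝ ℝ x).comp φ =
        MvPolynomial.aeval fun i => (x : E n) i := by
      refine MvPolynomial.algHom_ext fun i => ?_
      simp [φ, coord]
    exact DFunLike.congr_fun h p
  -- Stone–Weierstrass: the coordinate functions separate points.
  obtain ⟨⟨_, p, rfl⟩, hg⟩ := ContinuousMap.exists_mem_subalgebra_near_continuous_of_separatesPoints
    φ.range (by
      intro x y hxy
      have : ∃ i, (x : E n) i ≠ (y : E n) i := by
        by_contra! h
        exact hxy (Subtype.ext (by ext i; exact h i))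
      obtain ⟨i, hi⟩ := this
      refine ⟨_, ⟨φ (MvPolynomial.X i), ⟨_, rfl⟩, rfl⟩, ?_⟩
      simpa [φ, coord] using hi) u hu ε hε
  exact ⟨p, fun x => by simpa [hφ] using hg x⟩

/-! ### The Poisson operator on spherical harmonics -/

/-- The Poisson operator `u ↦ ∫ P_r(x · y) u(y) dy`. -/
noncomputable def poissonOp {n : ℕ} (r : ℝ) (u : Sph n → ℝ) (x : Sph n) : ℝ :=
  ∫ y, poissonKer n r (dot x y) * u y ∂(surf n)

theorem dot_comm {n : ℕ} (x y : Sph n) : dot x y = dot y x := real_inner_comm _ _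

theorem continuous_poissonKer_dot {n : ℕ} {r : ℝ} (hr0 : 0 ≤ r) (hr1 : r < 1) :
    Continuous fun q : Sph n × Sph n => poissonKer n r (dot q.1 q.2) := by
  simp_rw [poissonKer_dot]
  refine Continuous.div_const ?_ _
  exact (continuousOn_ballPoisson hr1).comp_continuous
    (f := fun q : Sph n × Sph n => (r • (q.1 : E n), q.2)) (by fun_prop)
    fun q => ⟨mem_closedBall_zero_iff.2 (norm_smul_sphere hr0 q.1).le, mem_univ _⟩

theorem continuous_poissonKer_dot_right {n : ℕ} {r : ℝ} (hr0 : 0 ≤ r) (hr1 : r < 1) (x : Sph n) :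
    Continuous fun y : Sph n => poissonKer n r (dot x y) :=
  (continuous_poissonKer_dot hr0 hr1).comp (f := fun y : Sph n => (x, y)) (by fun_prop)

theorem integral_poissonKer {n : ℕ} (hn : 3 ≤ n) {r : ℝ} (hr0 : 0 ≤ r) (hr1 : r < 1) (x : Sph n) :
    ∫ y, poissonKer n r (dot x y) ∂(surf n) = 1 := by
  have hω := sphereArea_pos hn
  simp_rw [poissonKer_dot]
  rw [integral_div, integral_ballPoisson hn (by rwa [norm_smul_sphere hr0]), div_self hω.ne']

theorem integrable_poissonKer_mul {n : ℕ} {r : ℝ} (hr0 : 0 ≤ r) (hr1 : r < 1) {u : Sph n → ℝ}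
    (hu : Continuous u) (x : Sph n) :
    Integrable (fun y => poissonKer n r (dot x y) * u y) (surf n) :=
  integrable_surf_of_continuous ((continuous_poissonKer_dot_right hr0 hr1 x).mul hu)

theorem poissonOp_add {n : ℕ} {r : ℝ} (hr0 : 0 ≤ r) (hr1 : r < 1) {u v : Sph n → ℝ}
    (hu : Continuous u) (hv : Continuous v) (x : Sph n) :
    poissonOp r (u + v) x = poissonOp r u x + poissonOp r v x := by
  simp only [poissonOp, Pi.add_apply, mul_add]
  exact integral_add (integrable_poissonKer_mul hr0 hr1 hu x)
    (integrable_poissonKer_mul hr0 hr1 hv x)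

/-- A nonnegative kernel of mass 1 contracts the sup norm. -/
theorem abs_poissonOp_le {n : ℕ} (hn : 3 ≤ n) {r : ℝ} (hr0 : 0 ≤ r) (hr1 : r < 1) {u : Sph n → ℝ}
    {M : ℝ} (hM : ∀ y, |u y| ≤ M) (x : Sph n) : |poissonOp r u x| ≤ M := by
  have h := norm_integral_le_of_norm_le (μ := surf n) (f := fun y => poissonKer n r (dot x y) * u y)
    ((integrable_poissonKer_mul hr0 hr1 (continuous_const (y := M)) x))
    (Filter.Eventually.of_forall fun y => by
      have h0 := poissonKer_nonneg hn hr0 hr1.le (dot_mem_Icc x y).2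
      rw [norm_mul, Real.norm_of_nonneg h0]
      exact mul_le_mul_of_nonneg_left (hM y) h0)
  rw [integral_mul_const, integral_poissonKer hn hr0 hr1, one_mul] at h
  exact h

theorem integrable_surf_mul {n : ℕ} {f g : Sph n → ℝ} (hf : Continuous f) (hg : Continuous g) :
    Integrable (fun x => f x * g x) (surf n) :=
  integrable_surf_of_continuous (hf.mul hg)

theorem integrable_surf_sq {n : ℕ} {f : Sph n → ℝ} (hf : Continuous f) :
    Integrable (fun x => f x ^ 2) (surf n) :=
  integrable_surf_of_continuous (hf.pow 2)

theorem continuous_of_mem_SH {n k : ℕ} {f : Sph n → ℝ} (hf : f ∈ SH n k) : Continuous f := by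
  obtain ⟨p, _, rfl⟩ := hf
  exact (continuous_polyEval p).comp continuous_subtype_val

/-- Spherical harmonics are eigenfunctions of the Poisson operator. -/
theorem poissonOp_of_mem_SH {n k : ℕ} (hn : 3 ≤ n) {f : Sph n → ℝ} (hf : f ∈ SH n k) {r : ℝ}
    (hr0 : 0 ≤ r) (hr1 : r < 1) (x : Sph n) : poissonOp r f x = r ^ k * f x := by
  obtain ⟨p, ⟨hk, hh⟩, rfl⟩ := hf
  have hh' : polyLaplacian n p = 0 := hh
  have hk' : p.IsHomogeneous k := hk
  have h := integral_poissonKer_mul_of_harmonic hn (continuous_polyEval p)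
    (fun X _ => by simpa [hh', polyEval] using hasLineLaplacianAt_polyEval p X) hr0 hr1 x
  rw [polyEval_smul_of_isHomogeneous hk'] at h
  exact h

theorem integral_poissonOp_mul {n : ℕ} {r : ℝ} (hr0 : 0 ≤ r) (hr1 : r < 1) {u v : Sph n → ℝ}
    (hu : Continuous u) (hv : Continuous v) :
    ∫ x, poissonOp r u x * v x ∂(surf n) = ∫ x, u x * poissonOp r v x ∂(surf n) := by
  have hc : Continuous fun q : Sph n × Sph n => poissonKer n r (dot q.1 q.2) * u q.2 * v q.1 :=
    ((continuous_poissonKer_dot hr0 hr1).mul (hu.comp continuous_snd)).mul (hv.comp continuous_fst)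
  have hi : Integrable (Function.uncurry fun x y : Sph n =>
      poissonKer n r (dot x y) * u y * v x) ((surf n).prod (surf n)) :=
    hc.integrable_of_hasCompactSupport (HasCompactSupport.of_compactSpace _)
  have h := integral_integral_swap hi
  simp only [poissonOp, ← integral_mul_const, ← integral_const_mul]
  rw [h]
  refine integral_congr_ae (Filter.Eventually.of_forall fun y => ?_)
  refine integral_congr_ae (Filter.Eventually.of_forall fun x => ?_)
  simp only [dot_comm x y]
  ring

/-- Spherical harmonics of different degrees are orthogonal. -/
theorem integral_mul_eq_zero_of_mem_SH {n k l : ℕ} (hn : 3 ≤ n) (hkl : k ≠ l) {f g : Sph n → ℝ}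
    (hf : f ∈ SH n k) (hg : g ∈ SH n l) : ∫ x, f x * g x ∂(surf n) = 0 := by
  -- A symmetric operator has orthogonal eigenfunctions for distinct eigenvalues; any r in (0,1)
  -- would separate r^k from r^l.
  have h := integral_poissonOp_mul (r := 1 / 2) (by norm_num) (by norm_num)
    (continuous_of_mem_SH hf) (continuous_of_mem_SH hg)
  simp only [poissonOp_of_mem_SH hn hf (r := 1 / 2) (by norm_num) (by norm_num),
    poissonOp_of_mem_SH hn hg (r := 1 / 2) (by norm_num) (by norm_num)] at h
  have e1 : ∀ x, (1 / 2 : ℝ) ^ k * f x * g x = (1 / 2) ^ k * (f x * g x) := fun x => by ring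
  have e2 : ∀ x, f x * ((1 / 2 : ℝ) ^ l * g x) = (1 / 2) ^ l * (f x * g x) := fun x => by ring
  simp only [e1, e2, integral_const_mul] at h
  have hne : (1 / 2 : ℝ) ^ k ≠ (1 / 2) ^ l := fun h' =>
    hkl (pow_right_injective₀ (by norm_num) (by norm_num) h')
  have h2 : ((1 / 2 : ℝ) ^ k - (1 / 2) ^ l) * ∫ x, f x * g x ∂(surf n) = 0 := by
    rw [sub_mul, h, sub_self]
  exact (mul_eq_zero.1 h2).resolve_left (sub_ne_zero.2 hne)

/-! ### The projectors -/

section Projectors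

variable {n : ℕ} {Y : (k : ℕ) → Fin (Module.finrank ℝ (SH n k)) → Sph n → ℝ}

theorem IsHarmonicONB.mem_SH (hY : IsHarmonicONB n Y) (k : ℕ) (l) : Y k l ∈ SH n k := by
  rw [← hY.span_eq k]
  exact Submodule.subset_span ⟨l, rfl⟩

theorem IsHarmonicONB.continuous (hY : IsHarmonicONB n Y) (k : ℕ) (l) : Continuous (Y k l) :=
  continuous_of_mem_SH (hY.mem_SH k l)

theorem proj_mem_SH (hY : IsHarmonicONB n Y) (k : ℕ) (u : Sph n → ℝ) : proj Y k u ∈ SH n k := by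
  have : proj Y k u = ∑ l, coeff Y u k l • Y k l := by
    funext x
    simp [proj]
  rw [this]
  exact Submodule.sum_mem _ fun l _ => Submodule.smul_mem _ _ (hY.mem_SH k l)

theorem coeff_add (hY : IsHarmonicONB n Y) {u v : Sph n → ℝ} (hu : Continuous u)
    (hv : Continuous v) (k : ℕ) (l) : coeff Y (u + v) k l = coeff Y u k l + coeff Y v k l := by
  simp only [coeff, Pi.add_apply, add_mul]
  exact integral_add (integrable_surf_of_continuous (hu.mul (hY.continuous k l)))
    (integrable_surf_of_continuous (hv.mul (hY.continuous k l)))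

theorem proj_add (hY : IsHarmonicONB n Y) {u v : Sph n → ℝ} (hu : Continuous u)
    (hv : Continuous v) (k : ℕ) (x : Sph n) :
    proj Y k (u + v) x = proj Y k u x + proj Y k v x := by
  simp only [proj, coeff_add hY hu hv, add_mul, Finset.sum_add_distrib]

theorem coeff_sum (hY : IsHarmonicONB n Y) (k : ℕ) (c : Fin (Module.finrank ℝ (SH n k)) → ℝ) (l) :
    coeff Y (fun x => ∑ l', c l' * Y k l' x) k l = c l := by
  simp only [coeff, Finset.sum_mul, mul_assoc]
  rw [integral_finsetSum _ fun l' _ =>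
    (integrable_surf_mul (hY.continuous k l') (hY.continuous k l)).const_mul (c l')]
  simp only [integral_const_mul]
  rw [Finset.sum_eq_single l]
  · rw [hY.normalized, mul_one]
  · intro l' _ h
    rw [hY.orthogonal k l' l h, mul_zero]
  · simp

theorem proj_of_mem_SH (hY : IsHarmonicONB n Y) {k : ℕ} {f : Sph n → ℝ} (hf : f ∈ SH n k)
    (x : Sph n) : proj Y k f x = f x := by
  rw [← hY.span_eq k] at hf
  obtain ⟨c, hc⟩ := (Submodule.mem_span_range_iff_exists_fun ℝ).1 hf
  have hc' : f = fun x => ∑ l, c l * Y k l x := by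
    rw [← hc]; funext x; simp
  simp only [proj, hc', coeff_sum hY]

theorem proj_of_mem_SH_of_ne (hn : 3 ≤ n) (hY : IsHarmonicONB n Y) {j k : ℕ} (hjk : j ≠ k)
    {f : Sph n → ℝ} (hf : f ∈ SH n j) (x : Sph n) : proj Y k f x = 0 := by
  refine Finset.sum_eq_zero fun l _ => ?_
  rw [coeff, integral_mul_eq_zero_of_mem_SH hn hjk hf (hY.mem_SH k l), zero_mul]

theorem integral_mul_proj (hY : IsHarmonicONB n Y) {u : Sph n → ℝ} (hu : Continuous u) (k : ℕ)
    (v : Sph n → ℝ) :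
    ∫ x, u x * proj Y k v x ∂(surf n) = ∑ l, coeff Y v k l * coeff Y u k l := by
  have e : ∀ x, u x * proj Y k v x = ∑ l, coeff Y v k l * (u x * Y k l x) := fun x => by
    rw [proj, Finset.mul_sum]
    exact Finset.sum_congr rfl fun l _ => by ring
  simp only [e]
  rw [integral_finsetSum _ fun l _ =>
    (integrable_surf_mul hu (hY.continuous k l)).const_mul (coeff Y v k l)]
  simp only [integral_const_mul, coeff]

/-- Bessel's inequality. -/
theorem integral_proj_sq_le (hY : IsHarmonicONB n Y) {u : Sph n → ℝ} (hu : Continuous u) (k : ℕ) :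
    ∫ x, proj Y k u x ^ 2 ∂(surf n) ≤ ∫ x, u x ^ 2 ∂(surf n) := by
  have hc := continuous_of_mem_SH (proj_mem_SH hY k u)
  have h1 : ∫ x, proj Y k u x ^ 2 ∂(surf n) = ∫ x, u x * proj Y k u x ∂(surf n) := by
    simp only [sq]
    rw [integral_mul_proj hY hu, integral_mul_proj hY hc]
    refine Finset.sum_congr rfl fun l _ => ?_
    congr 1
    exact coeff_sum hY k (coeff Y u k) l
  have i1 := integrable_surf_sq hu
  have i2 := integrable_surf_sq hc
  have h2 : ∫ x, u x * proj Y k u x ∂(surf n) ≤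
      ∫ x, (1 / 2 * u x ^ 2 + 1 / 2 * proj Y k u x ^ 2) ∂(surf n) :=
    integral_mono (integrable_surf_mul hu hc)
      ((i1.const_mul _).add (i2.const_mul _)) fun x => by
        simp only
        nlinarith [sq_nonneg (u x - proj Y k u x)]
  rw [integral_add (i1.const_mul _) (i2.const_mul _), integral_const_mul, integral_const_mul] at h2
  linarith

/-- r^k P_k u is the Poisson operator applied to P_k u. The bounded kernel and Bessel's inequality
then give a pointwise bound on P_k u without explicit sup-norm estimates of spherical harmonics. -/
theorem pow_mul_abs_proj_le (hn : 3 ≤ n) (hY : IsHarmonicONB n Y) {u : Sph n → ℝ}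
    (hu : Continuous u) {M : ℝ} (hM : 0 < M) (huM : ∀ x, |u x| ≤ M) {r : ℝ} (hr0 : 0 ≤ r)
    (hr1 : r < 1) (k : ℕ) (x : Sph n) :
    r ^ k * |proj Y k u x| ≤ (1 - r ^ 2) / (1 - r) ^ n * M := by
  have hω := sphereArea_pos hn
  have hmem := proj_mem_SH hY k u
  have hc := continuous_of_mem_SH hmem
  have hr2 : 0 ≤ 1 - r ^ 2 := by nlinarith
  have hr3 : 0 < 1 - r := by linarith
  set B : ℝ := (1 - r ^ 2) / (sphereArea n * (1 - r) ^ n) with hB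
  have hB0 : 0 ≤ B := by positivity
  have i2 := integrable_surf_sq hc
  have iM : Integrable (fun _ : Sph n => M / 2) (surf n) := integrable_const _
  have hsq : ∫ y, proj Y k u y ^ 2 ∂(surf n) ≤ sphereArea n * M ^ 2 := by
    refine (integral_proj_sq_le hY hu k).trans ?_
    have h := integral_mono (integrable_surf_sq hu)
      (integrable_const (μ := surf n) (M ^ 2)) fun y => sq_le_sq' (abs_le.1 (huM y)).1
        (abs_le.1 (huM y)).2
    rw [integral_const, surf_real_univ hn, smul_eq_mul] at h
    exact h
  have h1 : r ^ k * |proj Y k u x| = |poissonOp r (proj Y k u) x| := by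
    rw [poissonOp_of_mem_SH hn hmem hr0 hr1, abs_mul,
      abs_of_nonneg (pow_nonneg hr0 k)]
  have h2 := norm_integral_le_of_norm_le (μ := surf n)
    (f := fun y => poissonKer n r (dot x y) * proj Y k u y)
    (((iM.add (i2.const_mul (1 / (2 * M)))).const_mul B))
    (Filter.Eventually.of_forall fun y => by
      have h0 := poissonKer_nonneg hn hr0 hr1.le (dot_mem_Icc x y).2
      have hd := (dot_mem_Icc x y).2
      have hle : poissonKer n r (dot x y) ≤ B := poissonKer_le_of_sq_le hn hr0 hr1.le hr3
        (by nlinarith)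
      rw [norm_mul, Real.norm_of_nonneg h0]
      refine mul_le_mul hle ?_ (norm_nonneg _) hB0
      -- Weighted arithmetic-geometric mean in place of Cauchy–Schwarz, scaled so that both terms
      -- integrate to at most half of the area times M.
      have e : M / 2 + 1 / (2 * M) * proj Y k u y ^ 2 - ‖proj Y k u y‖ =
          (M - ‖proj Y k u y‖) ^ 2 / (2 * M) := by
        rw [Real.norm_eq_abs, ← sq_abs (proj Y k u y)]
        field_simp
        ring
      have : 0 ≤ (M - ‖proj Y k u y‖) ^ 2 / (2 * M) := by positivity
      simp only [Pi.add_apply]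
      linarith)
  simp only [Pi.add_apply] at h2
  rw [integral_const_mul, integral_add iM (i2.const_mul _), integral_const_mul, integral_const,
    surf_real_univ hn, smul_eq_mul] at h2
  rw [h1]
  refine h2.trans ?_
  calc _ ≤ B * (sphereArea n * (M / 2) + 1 / (2 * M) * (sphereArea n * M ^ 2)) := by gcongr
    _ = _ := by rw [hB]; field_simp; ring

/-- The previous bound is used at √r: one factor √r^k is spent on it, the other gives geometric
decay. The constants do not depend on u, as the density argument requires. -/
theorem exists_abs_pow_mul_proj_le (hn : 3 ≤ n) (hY : IsHarmonicONB n Y) {r : ℝ} (hr0 : 0 ≤ r)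
    (hr1 : r < 1) : ∃ A q : ℝ, 0 ≤ A ∧ 0 ≤ q ∧ q < 1 ∧ ∀ u : Sph n → ℝ, Continuous u →
      ∀ M, 0 < M → (∀ x, |u x| ≤ M) → ∀ k x, |r ^ k * proj Y k u x| ≤ A * M * q ^ k := by
  have hq0 := Real.sqrt_nonneg r
  have hq1 : √r < 1 := by rwa [Real.sqrt_lt' one_pos, one_pow]
  have h1 : 0 ≤ 1 - √r ^ 2 := by nlinarith
  have h2 : 0 < 1 - √r := by linarith
  refine ⟨(1 - √r ^ 2) / (1 - √r) ^ n, √r, by positivity, hq0, hq1, fun u hu M hM huM k x => ?_⟩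
  have h := pow_mul_abs_proj_le hn hY hu hM huM hq0 hq1 k x
  have e : r ^ k = √r ^ k * √r ^ k := by rw [← mul_pow, Real.mul_self_sqrt hr0]
  rw [abs_mul, abs_of_nonneg (pow_nonneg hr0 k), e, mul_assoc, mul_comm]
  exact mul_le_mul_of_nonneg_right h (by positivity)

theorem exists_abs_le_of_continuous {u : Sph n → ℝ} (hu : Continuous u) :
    ∃ M, 0 < M ∧ ∀ x, |u x| ≤ M := by
  obtain ⟨C, hC⟩ := isCompact_univ.exists_bound_of_continuousOn hu.continuousOn
  exact ⟨max C 1, by positivity, fun x => (hC x (mem_univ x)).trans (le_max_left _ _)⟩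

theorem summable_pow_mul_proj (hn : 3 ≤ n) (hY : IsHarmonicONB n Y) {u : Sph n → ℝ}
    (hu : Continuous u) {r : ℝ} (hr0 : 0 ≤ r) (hr1 : r < 1) (x : Sph n) :
    Summable fun k : ℕ => r ^ k * proj Y k u x := by
  obtain ⟨A, q, _, hq0, hq1, h⟩ := exists_abs_pow_mul_proj_le hn hY hr0 hr1
  obtain ⟨M, hM, huM⟩ := exists_abs_le_of_continuous hu
  exact Summable.of_norm_bounded ((summable_geometric_of_lt_one hq0 hq1).mul_left (A * M))
    fun k => h u hu M hM huM k x

theorem poissonOp_eq_tsum_of_mem_iSup (hn : 3 ≤ n) (hY : IsHarmonicONB n Y) {r : ℝ} (hr0 : 0 ≤ r)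
    (hr1 : r < 1) {u : Sph n → ℝ} (hu : u ∈ ⨆ k, SH n k) (x : Sph n) :
    Continuous u ∧ poissonOp r u x = ∑' k : ℕ, r ^ k * proj Y k u x := by
  induction hu using Submodule.iSup_induction' with
  | mem j f hf =>
    refine ⟨continuous_of_mem_SH hf, ?_⟩
    rw [tsum_eq_single j fun k hk => by rw [proj_of_mem_SH_of_ne hn hY hk.symm hf, mul_zero],
      proj_of_mem_SH hY hf, poissonOp_of_mem_SH hn hf hr0 hr1]
  | zero =>
    refine ⟨continuous_const, ?_⟩
    simp [poissonOp, proj, coeff]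
  | add f g _ _ hf hg =>
    refine ⟨hf.1.add hg.1, ?_⟩
    rw [poissonOp_add hr0 hr1 hf.1 hg.1, hf.2, hg.2,
      ← (summable_pow_mul_proj hn hY hf.1 hr0 hr1 x).tsum_add
        (summable_pow_mul_proj hn hY hg.1 hr0 hr1 x)]
    simp only [proj_add hY hf.1 hg.1, mul_add]

/-- The Poisson operator is the Abel sum of the expansion in spherical harmonics. -/
theorem poissonOp_eq_tsum (hn : 3 ≤ n) (hY : IsHarmonicONB n Y) {r : ℝ} (hr0 : 0 ≤ r)
    (hr1 : r < 1) {u : Sph n → ℝ} (hu : Continuous u) (x : Sph n) :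
    poissonOp r u x = ∑' k : ℕ, r ^ k * proj Y k u x := by
  obtain ⟨A, q, hA, hq0, hq1, hbound⟩ := exists_abs_pow_mul_proj_le hn hY hr0 hr1
  have hq2 : 0 < (1 - q)⁻¹ := inv_pos.2 (by linarith)
  rw [← sub_eq_zero, ← abs_nonpos_iff]
  refine le_of_forall_pos_le_add fun δ hδ => ?_
  rw [zero_add]
  -- An error of sup norm ε costs at most ε in the Poisson operator and Aε/(1-q) in the series.
  set ε := δ / (1 + A * (1 - q)⁻¹) with hε
  have hε0 : 0 < ε := by positivity
  obtain ⟨p, hp⟩ := exists_polyRestrict_near hu hε0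
  obtain ⟨hpc, hpe⟩ := poissonOp_eq_tsum_of_mem_iSup hn hY hr0 hr1
    (polyRestrict_mem_iSup_SH (by omega) p) x
  set v : Sph n → ℝ := u - polyRestrict n p with hv
  have hvc : Continuous v := hu.sub hpc
  have hvε : ∀ y, |v y| ≤ ε := fun y => by
    rw [hv, Pi.sub_apply, abs_sub_comm]; exact (hp y).le
  have huv : u = v + polyRestrict n p := by rw [hv]; simp
  have h1 : poissonOp r u x - ∑' k : ℕ, r ^ k * proj Y k u x =
      poissonOp r v x - ∑' k : ℕ, r ^ k * proj Y k v x := by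
    rw [huv, poissonOp_add hr0 hr1 hvc hpc]
    simp only [proj_add hY hvc hpc, mul_add]
    rw [(summable_pow_mul_proj hn hY hvc hr0 hr1 x).tsum_add
        (summable_pow_mul_proj hn hY hpc hr0 hr1 x), hpe]
    ring
  have h2 : |∑' k : ℕ, r ^ k * proj Y k v x| ≤ A * ε * (1 - q)⁻¹ :=
    tsum_of_norm_bounded (f := fun k : ℕ => r ^ k * proj Y k v x)
      ((hasSum_geometric_of_lt_one hq0 hq1).mul_left (A * ε))
      fun k => hbound v hvc ε hε0 hvε k x
  have h3 := abs_poissonOp_le hn hr0 hr1 hvε x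
  rw [h1]
  refine (abs_sub _ _).trans ?_
  calc _ ≤ ε + A * ε * (1 - q)⁻¹ := add_le_add h3 h2
    _ = ε * (1 + A * (1 - q)⁻¹) := by ring
    _ ≤ δ := (div_mul_cancel₀ δ (by positivity)).le

end Projectors

/-! ### The fractional operator as a convolution -/

/-- Continuity is the only consequence of smoothness that the argument needs. -/
theorem SmoothOnSphere.continuous {n : ℕ} {u : Sph n → ℝ} (hu : SmoothOnSphere u) :
    Continuous u := by
  obtain ⟨U, _, hU, hc⟩ := hu
  have h1 : u = fun x : Sph n => normalExt u (x : E n) := by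
    funext x
    have hx := norm_eq_of_mem_sphere x
    have h : ‖(x : E n)‖⁻¹ • (x : E n) = x := by rw [hx, inv_one, one_smul]
    have hmem : ‖(x : E n)‖⁻¹ • (x : E n) ∈ Metric.sphere (0 : E n) 1 := by
      rw [h]; exact x.2
    rw [normalExt, dif_pos hmem]
    congr 1
    exact Subtype.ext h.symm
  rw [h1]
  exact hc.continuousOn.comp_continuous continuous_subtype_val fun x => hU x.2

theorem fracOpIntegrand_eq {n : ℕ} (hn : 3 ≤ n)
    {Y : (k : ℕ) → Fin (Module.finrank ℝ (SH n k)) → Sph n → ℝ} (hY : IsHarmonicONB n Y) (s : ℝ)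
    {u : Sph n → ℝ} (hu : Continuous u) (x : Sph n) {t : ℝ} (ht : 0 < t) :
    fracOpIntegrand Y s u x t = timeWeight n s t * poissonOp (Real.exp (-t)) u x := by
  have h : dtnSemigroup Y t u x = poissonOp (Real.exp (-t)) u x := by
    rw [poissonOp_eq_tsum hn hY (Real.exp_pos _).le (Real.exp_lt_one_iff.2 (by linarith)) hu,
      dtnSemigroup, dtnCalculus]
    refine tsum_congr fun k => ?_
    rw [← Real.exp_nat_mul, mul_comm]
    ring_nf
  rw [fracOpIntegrand, timeWeight, h]
  ring

/-- For each t > 0 the integral over y of the absolute value is at most M w(t), where M bounds |u|,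
because the Poisson kernel has mass 1; integrability of w concludes. -/
theorem integrable_timeWeight_mul_poissonKer {n : ℕ} (hn : 3 ≤ n) {s : ℝ} (hs0 : 0 < s)
    (hs1 : s < 1) {u : Sph n → ℝ} (hu : Continuous u) (x : Sph n) :
    Integrable (fun q : ℝ × Sph n =>
      timeWeight n s q.1 * (poissonKer n (Real.exp (-q.1)) (dot x q.2) * u q.2))
      ((volume.restrict (Ioi 0)).prod (surf n)) := by
  have hG := integrableOn_timeWeight hn hs0 hs1
  obtain ⟨M, hM, huM⟩ := exists_abs_le_of_continuous hu
  have hmP : Measurable fun q : ℝ × Sph n => poissonKer n (Real.exp (-q.1)) (dot x q.2) := by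
    refine (measurable_poissonKer n).comp
      (f := fun q : ℝ × Sph n => (Real.exp (-q.1), dot x q.2)) ?_
    have : Continuous fun q : ℝ × Sph n => (Real.exp (-q.1), dot x q.2) := by
      unfold dot
      fun_prop
    exact this.measurable
  have hm : AEStronglyMeasurable (fun q : ℝ × Sph n =>
      timeWeight n s q.1 * (poissonKer n (Real.exp (-q.1)) (dot x q.2) * u q.2))
      ((volume.restrict (Ioi 0)).prod (surf n)) :=
    hG.1.comp_fst.mul
      (hmP.mul (hu.measurable.comp measurable_snd)).aestronglyMeasurable
  have hnorm : ∀ t, 0 < t → ∀ y : Sph n,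
      ‖timeWeight n s t * (poissonKer n (Real.exp (-t)) (dot x y) * u y)‖ =
        timeWeight n s t * (poissonKer n (Real.exp (-t)) (dot x y) * |u y|) := fun t ht y => by
    rw [norm_mul, norm_mul, Real.norm_of_nonneg (timeWeight_nonneg hn hs1 ht),
      Real.norm_of_nonneg (poissonKer_nonneg hn (Real.exp_pos _).le
        (Real.exp_le_one_iff.2 (by linarith)) (dot_mem_Icc x y).2), Real.norm_eq_abs]
  refine (integrable_prod_iff hm).2 ⟨?_, ?_⟩
  · refine (ae_restrict_iff' measurableSet_Ioi).2 (Filter.Eventually.of_forall fun t ht => ?_)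
    exact (integrable_poissonKer_mul (Real.exp_pos _).le
      (Real.exp_lt_one_iff.2 (neg_lt_zero.2 ht)) hu x).const_mul (timeWeight n s t)
  · refine (hG.mul_const M).mono' hm.norm.integral_prod_right' ?_
    refine (ae_restrict_iff' measurableSet_Ioi).2 (Filter.Eventually.of_forall fun t ht => ?_)
    have ht' : 0 < t := ht
    have h := abs_poissonOp_le hn (r := Real.exp (-t)) (Real.exp_pos _).le
      (Real.exp_lt_one_iff.2 (by linarith)) (u := fun y => |u y|) (M := M)
      (fun y => by rw [abs_abs]; exact huM y) x
    simp only [hnorm t ht', integral_const_mul]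
    rw [norm_mul, Real.norm_of_nonneg (timeWeight_nonneg hn hs1 ht')]
    exact mul_le_mul_of_nonneg_left h (timeWeight_nonneg hn hs1 ht')

/-- Valid even at y = x: pulling out a constant needs no integrability, a divergent integral having
the default value 0. -/
theorem integral_timeWeight_mul_poissonKer (n : ℕ) (s : ℝ) (u : Sph n → ℝ) (x y : Sph n) :
    fracKer n s (dot x y) * u y = fracConst n s *
      ∫ t in Ioi (0 : ℝ), timeWeight n s t * (poissonKer n (Real.exp (-t)) (dot x y) * u y) := by
  simp only [fracKer, fracKerIntegrand_eq]
  rw [mul_assoc, ← integral_mul_const]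
  simp only [mul_assoc]

end SphereFrac

theorem mainTheorem5 (n : ℕ) (hn : 3 ≤ n) (s : ℝ) (hs0 : 0 < s) (hs1 : s < 1) :
    -- the integral defining the kernel converges absolutely off the diagonal
    (∀ x y : SphereFrac.Sph n, x ≠ y →
      IntegrableOn (SphereFrac.fracKerIntegrand n s (SphereFrac.dot x y)) (Ioi 0)) ∧
    -- the kernel estimate
    (∃ c : ℝ, 0 < c ∧ ∀ x y : SphereFrac.Sph n, x ≠ y →
      |SphereFrac.fracKer n s (SphereFrac.dot x y)| ≤
        c / SphereFrac.geoDist x y ^ (((n : ℝ) - 1) - (2 - 2 * s))) ∧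
    -- `S^s` is well defined on smooth functions and is the convolution with the kernel
    (∀ Y : (k : ℕ) → Fin (Module.finrank ℝ (SphereFrac.SH n k)) → SphereFrac.Sph n → ℝ,
      SphereFrac.IsHarmonicONB n Y →
      ∀ u : SphereFrac.Sph n → ℝ, SphereFrac.SmoothOnSphere u → ∀ x : SphereFrac.Sph n,
        (∀ t : ℝ, 0 < t →
          Summable fun k : ℕ => Real.exp (-t * k) * SphereFrac.proj Y k u x) ∧
        IntegrableOn (SphereFrac.fracOpIntegrand Y s u x) (Ioi 0) ∧
        Integrable (fun y => SphereFrac.fracKer n s (SphereFrac.dot x y) * u y)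
          (SphereFrac.surf n) ∧
        SphereFrac.fracOp Y s u x =
          ∫ y, SphereFrac.fracKer n s (SphereFrac.dot x y) * u y ∂(SphereFrac.surf n)) := by
  refine ⟨fun x y h => SphereFrac.integrableOn_fracKerIntegrand_dot hn hs0 hs1 h,
    SphereFrac.exists_abs_fracKer_le hn hs0 hs1, fun Y hY u hu x => ?_⟩
  have huc := hu.continuous
  have hint := SphereFrac.integrable_timeWeight_mul_poissonKer hn hs0 hs1 huc x
  have hOp : ∀ t ∈ Ioi (0 : ℝ), ∫ y, SphereFrac.timeWeight n s t *
      (SphereFrac.poissonKer n (Real.exp (-t)) (SphereFrac.dot x y) * u y) ∂(SphereFrac.surf n) =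
      SphereFrac.fracOpIntegrand Y s u x t := fun t ht => by
    rw [SphereFrac.fracOpIntegrand_eq hn hY s huc x ht, integral_const_mul, SphereFrac.poissonOp]
  refine ⟨fun t ht => ?_, ?_, ?_, ?_⟩
  · refine (SphereFrac.summable_pow_mul_proj hn hY huc (Real.exp_pos (-t)).le
      (Real.exp_lt_one_iff.2 (by linarith)) x).congr fun k => ?_
    rw [← Real.exp_nat_mul, mul_comm (k : ℝ)]
  · exact IntegrableOn.congr_fun (f := fun t => ∫ y, SphereFrac.timeWeight n s t *
      (SphereFrac.poissonKer n (Real.exp (-t)) (SphereFrac.dot x y) * u y) ∂(SphereFrac.surf n))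
      hint.integral_prod_left hOp measurableSet_Ioi
  -- Integrability in y is the other half of Fubini; the pointwise kernel estimate is not needed
  -- here.
  · simp only [SphereFrac.integral_timeWeight_mul_poissonKer]
    exact hint.integral_prod_right.const_mul _
  · simp only [SphereFrac.integral_timeWeight_mul_poissonKer]
    rw [integral_const_mul, SphereFrac.fracOp, ← integral_integral_swap hint]
    congr 1
    exact (setIntegral_congr_fun measurableSet_Ioi hOp).symm
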